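/- Let $\mathcal B_0$ be the class of holomorphic functions $f$ on the open unit disc $\mathbb D$ with $0<|f(z)|\le 1$ for all $z\in\mathbb D$. For an integer $n\ge 1$ and $f(z)=\sum_{j\ge 0}a_jz^j\in\mathcal B_0$ put $M_n(f)=\operatorname{Re} a_n$, and call $f\in\mathcal B_0$ extremal for $M_n$ if $M_n(f)\ge M_n(F)$ for every $F\in\mathcal B_0$. **Theorem.** Let $c=\frac{2\pi}{7}\left(\frac1e-\frac13\right)>0$. For every integer $n\ge 1$, every extremal function $f$ for $M_n$ is an atomic singular inner function with finitely many atoms, up to a unimodular factor: there are an integer $N\ge 0$, numbers $\lambda_1,\dots,\lambda_N>0$, distinct points $\alpha_1,\dots,\alpha_N\in\partial\mathbb D$ and $\zeta\in\partial\mathbb D$ such that $$f(z)=\zeta\,\exp\left(-\sum_{j=1}^N\lambda_j\,\frac{1+\alpha_jz}{1-\alpha_jz}\right)\qquad(z\in\mathbb D);$$ and in every such representation the number of atoms satisfies $N\ge cn$. (Evaluating at $z=0$ shows that $\zeta=1$ when $f(0)>0$.) -/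

import Mathlib

/-- The class `𝓑₀`: holomorphic functions on the open unit disc with `0 < |f| ≤ 1` there.
(Values of `f` outside the disc are irrelevant.) -/
def KrzyzClass (f : ℂ → ℂ) : Prop :=
  DifferentiableOn ℂ f (Metric.ball 0 1) ∧ ∀ z ∈ Metric.ball (0 : ℂ) 1, 0 < ‖f z‖ ∧ ‖f z‖ ≤ 1

/-- The `n`th Taylor coefficient `a_n` of `f` at the origin. -/
noncomputable def taylorCoeffZero (n : ℕ) (f : ℂ → ℂ) : ℂ :=
  iteratedDeriv n f 0 / (n.factorial : ℂ)

/-- The functional `M_n(f) = Re a_n`. -/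
noncomputable def coeffFunctional (n : ℕ) (f : ℂ → ℂ) : ℝ :=
  (taylorCoeffZero n f).re

/-- `f` is extremal for `M_n`: it lies in `𝓑₀` and maximizes `M_n` over `𝓑₀`. -/
def IsExtremalFor (n : ℕ) (f : ℂ → ℂ) : Prop :=
  KrzyzClass f ∧ ∀ F : ℂ → ℂ, KrzyzClass F → coeffFunctional n F ≤ coeffFunctional n f

/-- `f` is, on the open unit disc, the atomic singular inner function with unimodular factor `ζ`
and with exactly `N` atoms, at the distinct points `α j` of the unit circle, of weights
`w j > 0`. If `f 0 > 0` then necessarily `ζ = 1`. -/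
def IsAtomicSingularInner (f : ℂ → ℂ) (N : ℕ) (ζ : ℂ) (w : Fin N → ℝ) (α : Fin N → ℂ) : Prop :=
  ‖ζ‖ = 1 ∧ (∀ j, 0 < w j) ∧ (∀ j, ‖α j‖ = 1) ∧ Function.Injective α ∧
    ∀ z ∈ Metric.ball (0 : ℂ) 1,
      f z = ζ * Complex.exp (-∑ j, (w j : ℂ) * ((1 + α j * z) / (1 - α j * z)))

/-! Structure. Write `f = exp (-g)` with `Re g ≥ 0`. If `Re h ≥ 0`, then `f exp (-εh)` stays in the
class, so extremality forces `Re a_n(f h) ≥ 0`. For `h = g` the opposite sign is allowed too (`ε ≤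
1`), so `Re a_n(f g) = 0`. For `h` the kernel `(w + z) / (w - z)` with `|w| = 1` one gets a
nonnegative trigonometric polynomial `T(w)`. Its extreme coefficients are `a_0 ≠ 0` and the
conjugate, so it has finitely many zeros. Up to an imaginary constant, `g` is the kernel integrated
against a positive measure, and `Re a_n(f g) = 0` says that `T` has integral zero for it; hence the
measure lives on the zeros of `T`. The proof works with the densities `Re g(r w)`, `r → 1`, instead
of the limit measure.

Counting. On the circle `f = ζ exp (iψ)` with `ψ(θ) = -∑ λ_j cot ((θ - x_j)/2)`, so `2π |a_n|` is
the modulus of the integral of `exp (i(ψ - nθ))` over a period. On each arc between consecutive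
atoms `ψ'` is positive and convex. Where `ψ' ≥ (1+s)n` or `ψ' ≤ (1-t)n`, the van der Corput test
bounds the contribution by `O(1/n)` per arc. If `[p, q]` is the part of the arc with `ψ' ≤ (1+s)n`,
the remaining contribution is at most `q - p`, and also at most `(ψ(q) - ψ(p)) / ((1-t)n)`.

These two bounds compete. The cotangent satisfies a trapezoidal inequality even across its poles, so
over the gap from one interval to the next `ψ` drops by at most `(1+s)n` times the gap. Since `ψ` is
periodic, the sum of the increments `ψ(q) - ψ(p)` is at most `(1+s)n (2π - ∑ (q - p))`. Combining
gives `|a_n| ≤ (1+s)/(2+s-t) + O(N/n)`. For suitable `s`, `t` the main term is below `2/e`, which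
the function `exp (-(1 - z^n)/(1 + z^n))` attains, so `N` is at least a constant times `n`. -/

open Complex Metric Set Filter Topology ComplexConjugate
open Real (circleAverage circleAverage_eq_circleIntegral circleAverage_congr_sphere)
open scoped Real

/-! ### Taylor coefficients at the origin -/

/-- Taylor coefficients at the origin as circle averages. -/
lemma taylorCoeffZero_eq_circleAverage {f : ℂ → ℂ} (hf : DifferentiableOn ℂ f (ball 0 1))
    {r : ℝ} (h0 : 0 < r) (h1 : r < 1) (n : ℕ) :
    taylorCoeffZero n f = circleAverage (fun z => f z / z ^ n) 0 r := by
  have hd : DifferentiableOn ℂ f (closedBall 0 r) := hf.mono (closedBall_subset_ball h1)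
  have key := hd.circleIntegral_one_div_sub_center_pow_smul h0 n
  rw [circleAverage_eq_circleIntegral h0.ne']
  have h2 : (∮ z in C(0, r), (z - 0)⁻¹ • (f z / z ^ n)) =
      ∮ z in C(0, r), (1 / (z - 0) ^ (n + 1)) • f z := by
    refine circleIntegral.integral_congr h0.le fun z hz => ?_
    have hz0 : z ≠ 0 := by
      rintro rfl
      simp [h0.ne] at hz
    simp only [sub_zero, smul_eq_mul]
    field_simp
    ring
  rw [h2, key, taylorCoeffZero, smul_smul]
  have : (2 * (π : ℂ) * I) ≠ 0 := two_pi_I_ne_zero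
  have hn : (n.factorial : ℂ) ≠ 0 := by exact_mod_cast n.factorial_ne_zero
  simp only [smul_eq_mul]
  field_simp

lemma taylorCoeffZero_congr {f g : ℂ → ℂ} (h : EqOn f g (ball 0 1)) (n : ℕ) :
    taylorCoeffZero n f = taylorCoeffZero n g := by
  unfold taylorCoeffZero
  have : f =ᶠ[nhds 0] g := Filter.eventuallyEq_of_mem (ball_mem_nhds 0 one_pos) h
  rw [this.iteratedDeriv_eq]

lemma taylorCoeffZero_const (c : ℂ) {n : ℕ} (hn : 1 ≤ n) :
    taylorCoeffZero n (fun _ => c) = 0 := by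
  unfold taylorCoeffZero
  rw [iteratedDeriv_const]
  simp [show n ≠ 0 by omega]

/-- A holomorphic function vanishing to higher order has a zero Taylor coefficient. -/
lemma taylorCoeffZero_pow_mul_eq_zero {s : ℂ → ℂ} (hs : DifferentiableOn ℂ s (ball 0 1))
    {m n : ℕ} (hmn : n < m) : taylorCoeffZero n (fun z => z ^ m * s z) = 0 := by
  have hd : DifferentiableOn ℂ (fun z => z ^ m * s z) (ball 0 1) := by fun_prop
  rw [taylorCoeffZero_eq_circleAverage hd (r := 1 / 2) (by norm_num) (by norm_num)]
  have h1 : circleAverage (fun z => z ^ m * s z / z ^ n) 0 (1 / 2) =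
      circleAverage (fun z => z ^ (m - n) * s z) 0 (1 / 2) := by
    refine circleAverage_congr_sphere fun z hz => ?_
    have hz0 : z ≠ 0 := by
      rintro rfl
      simp at hz
    obtain ⟨k, rfl⟩ := Nat.exists_eq_add_of_lt hmn
    simp only [show n + k + 1 - n = k + 1 by omega]
    field_simp
    ring
  rw [h1, DiffContOnCl.circleAverage]
  · simp [show m - n ≠ 0 by omega]
  · apply DifferentiableOn.diffContOnCl
    have : DifferentiableOn ℂ s (closure (ball 0 |1 / 2|)) := hs.mono <|
      (closure_ball_subset_closedBall).trans (closedBall_subset_ball (by norm_num [abs_of_pos]))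
    fun_prop

lemma taylorCoeffZero_pow_mul {s : ℂ → ℂ} (hs : DifferentiableOn ℂ s (ball 0 1))
    {m n : ℕ} (hmn : m ≤ n) :
    taylorCoeffZero n (fun z => z ^ m * s z) = taylorCoeffZero (n - m) s := by
  have hd : DifferentiableOn ℂ (fun z => z ^ m * s z) (ball 0 1) := by fun_prop
  rw [taylorCoeffZero_eq_circleAverage hd (r := 1 / 2) (by norm_num) (by norm_num),
    taylorCoeffZero_eq_circleAverage hs (r := 1 / 2) (by norm_num) (by norm_num)]
  refine circleAverage_congr_sphere fun z hz => ?_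
  have hz0 : z ≠ 0 := by
    rintro rfl
    simp at hz
  obtain ⟨k, rfl⟩ := Nat.exists_eq_add_of_le hmn
  simp only [show m + k - m = k by omega]
  field_simp
  ring

lemma contDiffAt_of_differentiableOn_ball {f : ℂ → ℂ} (hf : DifferentiableOn ℂ f (ball 0 1))
    (n : ℕ) : ContDiffAt ℂ n f 0 :=
  (hf.analyticAt (ball_mem_nhds 0 one_pos)).contDiffAt

lemma taylorCoeffZero_add {f g : ℂ → ℂ} (hf : DifferentiableOn ℂ f (ball 0 1))
    (hg : DifferentiableOn ℂ g (ball 0 1)) (n : ℕ) :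
    taylorCoeffZero n (fun z => f z + g z) = taylorCoeffZero n f + taylorCoeffZero n g := by
  unfold taylorCoeffZero
  rw [← add_div]
  congr 1
  exact iteratedDeriv_add (contDiffAt_of_differentiableOn_ball hf n)
    (contDiffAt_of_differentiableOn_ball hg n)

lemma taylorCoeffZero_const_mul {f : ℂ → ℂ} (hf : DifferentiableOn ℂ f (ball 0 1)) (c : ℂ)
    (n : ℕ) : taylorCoeffZero n (fun z => c * f z) = c * taylorCoeffZero n f := by
  unfold taylorCoeffZero
  rw [← mul_div_assoc]
  congr 1
  exact iteratedDeriv_const_mul c (contDiffAt_of_differentiableOn_ball hf n)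

/-- Cauchy's estimate on `|z| = 1/2`. The size of the constant is irrelevant: it serves for
remainder terms with `n` fixed. -/
lemma norm_taylorCoeffZero_le {f : ℂ → ℂ} (hf : DifferentiableOn ℂ f (ball 0 1)) {C : ℝ}
    (hC : ∀ z ∈ sphere (0 : ℂ) (1 / 2), ‖f z‖ ≤ C) (n : ℕ) :
    ‖taylorCoeffZero n f‖ ≤ C * 2 ^ n := by
  have h := norm_iteratedDeriv_le_of_forall_mem_sphere_norm_le n (by norm_num : (0 : ℝ) < 1 / 2)
    (DifferentiableOn.diffContOnCl (hf.mono <| (closure_ball_subset_closedBall).trans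
      (closedBall_subset_ball (by norm_num)))) hC
  unfold taylorCoeffZero
  rw [norm_div, norm_natCast, div_le_iff₀ (by positivity)]
  refine h.trans (le_of_eq ?_)
  simp only [one_div, inv_pow]
  field_simp

/-! ### Logarithms, the lower bound `2/e`, and the first variation -/

/-- A zero-free holomorphic function on the disc bounded by `1` is `exp (-g)` with `0 ≤ re g`. -/
lemma KrzyzClass.exists_log {f : ℂ → ℂ} (hf : KrzyzClass f) :
    ∃ g : ℂ → ℂ, DifferentiableOn ℂ g (ball 0 1) ∧ (∀ z ∈ ball (0 : ℂ) 1, 0 ≤ (g z).re) ∧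
      ∀ z ∈ ball (0 : ℂ) 1, f z = exp (-g z) := by
  obtain ⟨hd, hb⟩ := hf
  have hne : ∀ z ∈ ball (0 : ℂ) 1, f z ≠ 0 := fun z hz => norm_pos_iff.1 (hb z hz).1
  have hd' : DifferentiableOn ℂ (deriv f) (ball 0 1) := hd.deriv isOpen_ball
  have hq : DifferentiableOn ℂ (fun z => -(deriv f z / f z)) (ball 0 1) := (hd'.div hd hne).neg
  -- A primitive of `-f'/f`, normalised so that `f exp g` has derivative zero and value one at the
  -- origin.
  obtain ⟨g, hg0, hg⟩ := hq.isExactOn_ball.with_val_at 0 (-log (f 0))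
  have hder : ∀ z ∈ ball (0 : ℂ) 1, HasDerivAt (fun w => f w * exp (g w)) 0 z := by
    intro z hz
    have h1 := (hd.differentiableAt (isOpen_ball.mem_nhds hz)).hasDerivAt
    have h2 := h1.mul (hg z hz).cexp
    convert! h2 using 1
    field_simp [hne z hz]
    ring
  have hconst : ∀ z ∈ ball (0 : ℂ) 1, f z * exp (g z) = 1 := by
    intro z hz
    have := isOpen_ball.is_const_of_deriv_eq_zero (convex_ball (0 : ℂ) 1).isPreconnected
      (fun w hw => (hder w hw).differentiableAt.differentiableWithinAt)
      (fun w hw => (hder w hw).deriv) hz (mem_ball_self one_pos)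
    rw [this, hg0, exp_neg, exp_log (hne 0 (mem_ball_self one_pos)),
      mul_inv_cancel₀ (hne 0 (mem_ball_self one_pos))]
  have hexp : ∀ z ∈ ball (0 : ℂ) 1, f z = exp (-g z) := fun z hz => by
    rw [exp_neg, eq_inv_of_mul_eq_one_left (hconst z hz)]
  refine ⟨g, fun z hz => (hg z hz).differentiableAt.differentiableWithinAt, fun z hz => ?_, hexp⟩
  have := (hb z hz).2
  rw [hexp z hz, norm_exp] at this
  simpa using this

/-- The sharp example gives `2 / e` as a lower bound for the extremal value. -/
lemma IsExtremalFor.two_div_exp_le {n : ℕ} {f : ℂ → ℂ} (hn : 1 ≤ n) (hf : IsExtremalFor n f) :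
    2 / Real.exp 1 ≤ (taylorCoeffZero n f).re := by
  set Φ : ℂ → ℂ := fun w => exp (-((1 - w) / (1 + w))) with hΦ
  have hne : ∀ w ∈ ball (0 : ℂ) 1, 1 + w ≠ 0 := by
    intro w hw h
    have : w = -1 := by linear_combination h
    simp [this] at hw
  have hΦd : DifferentiableOn ℂ Φ (ball 0 1) := by
    intro w hw
    have := hne w hw
    apply DifferentiableAt.differentiableWithinAt
    fun_prop (disch := assumption)
  have hpow : ∀ z ∈ ball (0 : ℂ) 1, z ^ n ∈ ball (0 : ℂ) 1 := by
    intro z hz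
    simp only [mem_ball_zero_iff, norm_pow] at *
    exact pow_lt_one₀ (norm_nonneg _) hz (by omega)
  have hFd : DifferentiableOn ℂ (fun z => Φ (z ^ n)) (ball 0 1) :=
    hΦd.comp (by fun_prop) hpow
  have hK : KrzyzClass (fun z => Φ (z ^ n)) := by
    refine ⟨hFd, fun z hz => ⟨norm_pos_iff.2 (exp_ne_zero _), ?_⟩⟩
    have hw := hpow z hz
    set w := z ^ n
    simp only [hΦ, norm_exp]
    rw [Real.exp_le_one_iff, neg_re, neg_nonpos, Complex.div_re, ← add_div]
    apply div_nonneg _ (normSq_nonneg _)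
    have : normSq w < 1 := by
      rw [mem_ball_zero_iff] at hw
      rw [normSq_eq_norm_sq]
      nlinarith [norm_nonneg w]
    rw [normSq_apply] at this
    simp
    nlinarith
  have hval := hf.2 _ hK
  set R := dslope (dslope Φ 0) 0
  have hmem : ball (0 : ℂ) 1 ∈ nhds (0 : ℂ) := ball_mem_nhds 0 one_pos
  have hR : DifferentiableOn ℂ R (ball 0 1) :=
    (differentiableOn_dslope hmem).2 ((differentiableOn_dslope hmem).2 hΦd)
  have hderiv : HasDerivAt Φ (2 / exp 1) 0 := by
    have h1 : HasDerivAt (fun w : ℂ => -((1 - w) / (1 + w))) 2 0 := by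
      have h := ((hasDerivAt_id' (0 : ℂ)).const_sub 1).fun_div
        ((hasDerivAt_id' (0 : ℂ)).const_add 1) (by simp)
      convert! h.neg using 1
      norm_num
    convert! h1.cexp using 1
    norm_num [exp_neg]
    field_simp
  -- With `w = z ^ n` the remainder has order at least `2n > n`, so only the linear term contributes
  -- to the coefficient.
  have hexpand : ∀ w, Φ w = Φ 0 + (2 / exp 1) * w + w ^ 2 * R w := by
    intro w
    have h1 := sub_smul_dslope Φ 0 w
    have h2 := sub_smul_dslope (dslope Φ 0) 0 w
    rw [dslope_same, hderiv.deriv] at h2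
    simp only [sub_zero, smul_eq_mul] at h1 h2
    linear_combination -h1 - w * h2
  have hR' : DifferentiableOn ℂ (fun z => R (z ^ n)) (ball 0 1) := hR.comp (by fun_prop) hpow
  have hcoef : taylorCoeffZero n (fun z => Φ (z ^ n)) = 2 / exp 1 := by
    have : (fun z => Φ (z ^ n)) = fun z => (Φ 0 + z ^ n * (2 / exp 1)) + z ^ (2 * n) * R (z ^ n) := by
      funext z
      rw [hexpand (z ^ n)]
      ring
    have hq : DifferentiableOn ℂ (fun z => z ^ (2 * n) * R (z ^ n)) (ball 0 1) :=
      (by fun_prop : DifferentiableOn ℂ (fun z : ℂ => z ^ (2 * n)) (ball 0 1)).mul hR'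
    rw [this, taylorCoeffZero_add (by fun_prop) hq, taylorCoeffZero_add (by fun_prop)
      (by fun_prop), taylorCoeffZero_const _ hn, taylorCoeffZero_pow_mul (s := fun _ => 2 / exp 1)
      (by fun_prop) le_rfl, taylorCoeffZero_pow_mul_eq_zero (s := fun z => R (z ^ n)) hR' (by omega)]
    simp [taylorCoeffZero]
  rw [coeffFunctional, hcoef] at hval
  have h3 : ((2 : ℂ) / exp 1).re = 2 / Real.exp 1 := by
    rw [show (2 : ℂ) / exp 1 = ((2 / Real.exp 1 : ℝ) : ℂ) by push_cast; rfl, ofReal_re]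
  rw [h3] at hval
  exact hval

/-- First variation: if `f * exp (-ε h)` stays in the class for `ε ∈ [0, 1]`, then the `n`th
coefficient of `f * h` has nonnegative real part. -/
lemma IsExtremalFor.re_taylorCoeffZero_mul_nonneg {n : ℕ} {f h : ℂ → ℂ} (hf : IsExtremalFor n f)
    (hh : DifferentiableOn ℂ h (ball 0 1))
    (hv : ∀ ε : ℝ, 0 ≤ ε → ε ≤ 1 → KrzyzClass fun z => f z * exp (-(ε * h z))) :
    0 ≤ (taylorCoeffZero n fun z => f z * h z).re := by
  have hfd := hf.1.1
  have hcont : ContinuousOn h (sphere (0 : ℂ) (1 / 2)) := hh.continuousOn.mono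
    (sphere_subset_closedBall.trans (closedBall_subset_ball (by norm_num)))
  obtain ⟨B, hB⟩ := (isCompact_sphere (0 : ℂ) (1 / 2)).exists_bound_of_continuousOn hcont
  set B' := max B 1
  have hB' : ∀ z ∈ sphere (0 : ℂ) (1 / 2), ‖h z‖ ≤ B' := fun z hz =>
    (hB z hz).trans (le_max_left _ _)
  have hB1 : 1 ≤ B' := le_max_right _ _
  by_contra! hneg
  set δ := -(taylorCoeffZero n fun z => f z * h z).re with hδ
  have hδ0 : 0 < δ := by linarith
  set K := B' ^ 2 * 2 ^ n with hK
  have hK0 : 0 < K := by positivity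
  -- The first entry makes `|ε h| ≤ 1` on the circle, as the exponential remainder bound needs; the
  -- second makes the quadratic error `ε²K` at most half of the linear gain `εδ`.
  set ε := min (1 / B') (δ / (2 * K)) with hε
  have hε0 : 0 < ε := by positivity
  have hε1 : ε * B' ≤ 1 := by
    calc ε * B' ≤ 1 / B' * B' := by gcongr; exact min_le_left _ _
      _ = 1 := by field_simp
  have hε2 : ε ≤ 1 := by nlinarith
  have hKr := hv ε hε0.le hε2
  set s : ℂ → ℂ := fun z => f z * (exp (-(ε * h z)) - 1 - (-(ε * h z)))
  have hs : DifferentiableOn ℂ s (ball 0 1) := by fun_prop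
  have hdec : (fun z => f z * exp (-(ε * h z))) = fun z => (f z + (-ε : ℂ) * (f z * h z)) + s z := by
    funext z
    simp only [s]
    ring
  have hsn : ‖taylorCoeffZero n s‖ ≤ (ε * B') ^ 2 * 2 ^ n := by
    refine norm_taylorCoeffZero_le hs (fun z hz => ?_) n
    have hzb : z ∈ ball (0 : ℂ) 1 := by
      simp only [mem_sphere_iff_norm, sub_zero] at hz
      simp [hz]
      norm_num
    have h1 : ‖-((ε : ℂ) * h z)‖ ≤ ε * B' := by
      rw [norm_neg, norm_mul, norm_real, Real.norm_of_nonneg hε0.le]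
      gcongr
      exact hB' z hz
    have h2 := norm_exp_sub_one_sub_id_le (h1.trans hε1)
    calc ‖s z‖ = ‖f z‖ * ‖exp (-(ε * h z)) - 1 - (-(ε * h z))‖ := norm_mul _ _
      _ ≤ 1 * (ε * B') ^ 2 := by
        gcongr
        · exact (hf.1.2 z hzb).2
        · exact h2.trans (by gcongr)
      _ = _ := one_mul _
  have hval := hf.2 _ hKr
  rw [coeffFunctional, coeffFunctional, hdec, taylorCoeffZero_add (by fun_prop) hs,
    taylorCoeffZero_add hfd (by fun_prop), taylorCoeffZero_const_mul (by fun_prop)] at hval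
  have h4 : ((-ε : ℂ) * taylorCoeffZero n fun z => f z * h z).re = ε * δ := by
    rw [← ofReal_neg, re_ofReal_mul]
    rw [hδ]
    ring
  rw [add_re, add_re, h4] at hval
  have h5 := (abs_le.1 ((abs_re_le_norm _).trans hsn)).1
  have h6 : (ε * B') ^ 2 * 2 ^ n = ε * (ε * K) := by rw [hK]; ring
  have h7 : ε * K ≤ δ / 2 := by
    calc ε * K ≤ δ / (2 * K) * K := by gcongr; exact min_le_right _ _
      _ = δ / 2 := by field_simp
  rw [h6] at h5
  nlinarith

/-! ### The half-plane kernel and the Schwarz formula -/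

/-- The function `z ↦ (1 + α z) / (1 - α z)`. -/
noncomputable def halfPlaneMap (α z : ℂ) : ℂ := (1 + α * z) / (1 - α * z)

lemma one_sub_mul_ne_zero {α z : ℂ} (hα : ‖α‖ = 1) (hz : z ∈ ball (0 : ℂ) 1) : 1 - α * z ≠ 0 := by
  intro h
  have h1 : α * z = 1 := by linear_combination -h
  have h2 : ‖z‖ = 1 := by simpa [hα] using congrArg norm h1
  simp [h2] at hz

lemma differentiableOn_halfPlaneMap {α : ℂ} (hα : ‖α‖ = 1) :
    DifferentiableOn ℂ (halfPlaneMap α) (ball 0 1) := by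
  intro z hz
  have := one_sub_mul_ne_zero hα hz
  apply DifferentiableAt.differentiableWithinAt
  unfold halfPlaneMap
  fun_prop (disch := assumption)

lemma re_halfPlaneMap_nonneg {α : ℂ} (hα : ‖α‖ = 1) {z : ℂ} (hz : z ∈ ball (0 : ℂ) 1) :
    0 ≤ (halfPlaneMap α z).re := by
  have hw : normSq (α * z) < 1 := by
    rw [mem_ball_zero_iff] at hz
    rw [normSq_eq_norm_sq, norm_mul, hα]
    nlinarith [norm_nonneg z]
  unfold halfPlaneMap
  generalize α * z = w at *
  rw [Complex.div_re, ← add_div]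
  apply div_nonneg _ (normSq_nonneg _)
  rw [normSq_apply] at hw
  simp
  nlinarith

lemma circleIntegrable_of_continuousOn {E : Type*} [NormedAddCommGroup E] {φ : ℂ → E} {r : ℝ}
    (hr : 0 ≤ r) (hφ : ContinuousOn φ (sphere 0 r)) : CircleIntegrable φ 0 r :=
  hφ.circleIntegrable hr

lemma circleAverage_conj {φ : ℂ → ℂ} {r : ℝ} (hφ : CircleIntegrable φ 0 r) :
    circleAverage (fun w => conj (φ w)) 0 r = conj (circleAverage φ 0 r) :=
  (conjCLE : ℂ ≃L[ℝ] ℂ).toContinuousLinearMap.circleAverage_comp_comm hφ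

lemma circleAverage_re {φ : ℂ → ℂ} {r : ℝ} (hφ : CircleIntegrable φ 0 r) :
    circleAverage (fun w => (φ w).re) 0 r = (circleAverage φ 0 r).re :=
  reCLM.circleAverage_comp_comm hφ

/-- **Schwarz integral formula** on the unit disc. -/
lemma circleAverage_halfPlaneMap_mul_re {G : ℂ → ℂ} (hG : DiffContOnCl ℂ G (ball 0 1)) {z : ℂ}
    (hz : z ∈ ball (0 : ℂ) 1) :
    circleAverage (fun w => halfPlaneMap w⁻¹ z * ((G w).re : ℂ)) 0 1 = G z - (G 0).im * I := by
  have hGc : ContinuousOn G (sphere 0 1) := by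
    refine hG.continuousOn.mono ?_
    rw [closure_ball _ one_ne_zero]
    exact sphere_subset_closedBall
  have hz1 : ‖z‖ < 1 := by simpa using hz
  have hne : ∀ w ∈ sphere (0 : ℂ) 1, w - z ≠ 0 := by
    intro w hw h
    rw [sub_eq_zero.1 h] at hw
    simp at hw
    linarith
  have hw0 : ∀ w ∈ sphere (0 : ℂ) 1, w ≠ 0 := by
    rintro w hw rfl
    simp at hw
  -- On the unit circle `conj w = w⁻¹`, so `(w + z)/(w - z) * conj (G w)` is the conjugate of `H w`.
  -- As `H` is holomorphic, its mean is `H 0 = G 0`. The other half of `Re G` is handled by Cauchy's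
  -- formula, since `(w + z)/(w - z) = 2w/(w - z) - 1`.
  set H : ℂ → ℂ := fun w => (1 + w * conj z) / (1 - w * conj z) * G w with hH
  have hden : ∀ w ∈ closedBall (0 : ℂ) 1, 1 - w * conj z ≠ 0 := by
    intro w hw h
    have h1 : w * conj z = 1 := by linear_combination -h
    have h2 := congrArg norm h1
    simp only [norm_mul, RCLike.norm_conj, norm_one] at h2
    simp only [mem_closedBall_zero_iff] at hw
    nlinarith [norm_nonneg z, norm_nonneg w]
  have hHd : DiffContOnCl ℂ H (ball 0 1) := by
    refine DiffContOnCl.smul (𝕜' := ℂ) (c := fun w => (1 + w * conj z) / (1 - w * conj z))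
      (DifferentiableOn.diffContOnCl ?_) hG
    rw [closure_ball _ one_ne_zero]
    intro w hw
    have := hden w hw
    apply DifferentiableAt.differentiableWithinAt
    fun_prop (disch := assumption)
  have hHc : ContinuousOn H (sphere 0 1) := by
    refine hHd.continuousOn.mono ?_
    rw [closure_ball _ one_ne_zero]
    exact sphere_subset_closedBall
  have h1 : circleAverage (fun w => w / (w - z) * G w) 0 1 = G z := by
    have := DiffContOnCl.circleAverage_smul_div (R := 1) (c := 0) (f := G) (w := z)
      (by simpa using hG) (by simpa using hz)
    simpa using this
  have h2 : circleAverage G 0 1 = G 0 := DiffContOnCl.circleAverage (by simpa using hG)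
  have h3 : circleAverage (fun w => conj (H w)) 0 1 = conj (G 0) := by
    rw [circleAverage_conj (circleIntegrable_of_continuousOn zero_le_one hHc),
      DiffContOnCl.circleAverage (by simpa using hHd)]
    simp [hH]
  have c1 : ContinuousOn (fun w => w / (w - z) * G w) (sphere 0 1) :=
    (continuousOn_id.div (by fun_prop) hne).mul hGc
  have c3 : ContinuousOn (fun w => conj (H w)) (sphere 0 1) := continuous_conj.comp_continuousOn hHc
  have i1 := circleIntegrable_of_continuousOn zero_le_one c1
  have i2 := circleIntegrable_of_continuousOn zero_le_one hGc
  have i3 := circleIntegrable_of_continuousOn zero_le_one c3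
  have i2' : CircleIntegrable (fun w => (1 / 2 : ℂ) • G w) 0 1 := i2.const_smul
  have i3' : CircleIntegrable (fun w => (1 / 2 : ℂ) • conj (H w)) 0 1 := i3.const_smul
  have h4 : circleAverage (fun w => halfPlaneMap w⁻¹ z * ((G w).re : ℂ)) 0 1 =
      circleAverage (fun w => (w / (w - z) * G w - (1 / 2 : ℂ) • G w) + (1 / 2 : ℂ) • conj (H w))
        0 1 := by
    refine circleAverage_congr_sphere fun w hw => ?_
    rw [abs_one] at hw
    have hw0' := hw0 w hw
    have hn := hne w hw
    have hcw : conj w = w⁻¹ := by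
      rw [Complex.inv_def, normSq_eq_norm_sq, mem_sphere_zero_iff_norm.1 hw]
      simp
    have hk : conj (H w) = (w + z) / (w - z) * conj (G w) := by
      have hn' : 1 - w⁻¹ * z ≠ 0 := by
        intro h
        apply hn
        field_simp at h
        simpa using h
      simp only [hH, map_mul, map_div₀, map_add, map_sub, map_one, conj_conj, hcw]
      congr 1
      field_simp
    have hk2 : halfPlaneMap w⁻¹ z = (w + z) / (w - z) := by
      have hn' : 1 - w⁻¹ * z ≠ 0 := by
        intro h
        apply hn
        field_simp at h
        simpa using h
      unfold halfPlaneMap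
      field_simp
    simp only [smul_eq_mul]
    rw [hk, hk2, re_eq_add_conj]
    field_simp
    ring
  have i12 : CircleIntegrable (fun w => w / (w - z) * G w - (1 / 2 : ℂ) • G w) 0 1 := i1.sub i2'
  rw [h4, Real.circleAverage_fun_add i12 i3', Real.circleAverage_fun_sub i1 i2',
    Real.circleAverage_fun_smul, Real.circleAverage_fun_smul, h1, h2, h3]
  simp only [smul_eq_mul]
  apply Complex.ext <;> simp <;> ring

/-! ### Limits of concentrating densities -/

/-- If nonnegative densities concentrate where `T ≥ 0` vanishes, averages of functions vanishing
there tend to zero. -/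
lemma tendsto_circleAverage_zero_of_concentrated {p : ℕ → ℂ → ℝ} {T : ℂ → ℝ} {φ : ℂ → ℂ} {c : ℝ}
    (hp : ∀ m, ContinuousOn (p m) (sphere 0 1)) (hp0 : ∀ m, ∀ w ∈ sphere (0 : ℂ) 1, 0 ≤ p m w)
    (hpc : ∀ m, circleAverage (p m) 0 1 = c) (hT : ContinuousOn T (sphere 0 1))
    (hT0 : ∀ w ∈ sphere (0 : ℂ) 1, 0 ≤ T w)
    (hlim : Tendsto (fun m => circleAverage (fun w => p m w * T w) 0 1) atTop (𝓝 0))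
    (hφ : ContinuousOn φ (sphere 0 1)) (hφ0 : ∀ w ∈ sphere (0 : ℂ) 1, T w = 0 → φ w = 0) :
    Tendsto (fun m => circleAverage (fun w => (p m w : ℂ) * φ w) 0 1) atTop (𝓝 0) := by
  have hc0 : 0 ≤ c := by
    rw [← hpc 0]
    exact Real.circleAverage_nonneg_of_nonneg (by simpa using hp0 0)
  -- On the compact set where `|φ| ≥ ε` the function `T` has a positive minimum, so a multiple of
  -- `T` dominates `φ` there.
  have key : ∀ ε > 0, ∃ C, 0 ≤ C ∧ ∀ w ∈ sphere (0 : ℂ) 1, ‖φ w‖ ≤ ε + C * T w := by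
    intro ε hε
    obtain ⟨B, hB⟩ := (isCompact_sphere (0 : ℂ) 1).exists_bound_of_continuousOn hφ
    set K := sphere (0 : ℂ) 1 ∩ (fun w => ‖φ w‖) ⁻¹' Ici ε
    have hK : IsCompact K := by
      refine (isCompact_sphere (0 : ℂ) 1).of_isClosed_subset ?_ inter_subset_left
      exact hφ.norm.preimage_isClosed_of_isClosed isClosed_sphere isClosed_Ici
    rcases K.eq_empty_or_nonempty with hKe | hKn
    · refine ⟨0, le_rfl, fun w hw => ?_⟩
      by_contra! h
      have : w ∈ K := ⟨hw, by simp at h; exact h.le⟩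
      simp [hKe] at this
    · obtain ⟨w₀, hw₀, hmin⟩ := hK.exists_isMinOn hKn (hT.mono inter_subset_left)
      have hpos : 0 < T w₀ := by
        refine (hT0 w₀ hw₀.1).lt_of_ne fun h => ?_
        have h1 := hw₀.2
        simp only [mem_preimage, mem_Ici, hφ0 w₀ hw₀.1 h.symm, norm_zero] at h1
        linarith
      have hB0 : 0 ≤ B := (norm_nonneg _).trans (hB w₀ hw₀.1)
      refine ⟨B / T w₀, by positivity, fun w hw => ?_⟩
      by_cases hwK : w ∈ K
      · have h1 : T w₀ ≤ T w := hmin hwK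
        calc ‖φ w‖ ≤ B := hB w hw
          _ = B / T w₀ * T w₀ := by field_simp
          _ ≤ B / T w₀ * T w := by gcongr
          _ ≤ _ := by linarith
      · have h1 : ‖φ w‖ < ε := by
          by_contra! h
          exact hwK ⟨hw, h⟩
        have : 0 ≤ B / T w₀ * T w := mul_nonneg (by positivity) (hT0 w hw)
        linarith
  have hbound : ∀ ε > 0, ∃ C, 0 ≤ C ∧ ∀ m, ‖circleAverage (fun w => (p m w : ℂ) * φ w) 0 1‖ ≤
      ε * c + C * circleAverage (fun w => p m w * T w) 0 1 := by
    intro ε hε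
    obtain ⟨C, hC0, hC⟩ := key ε hε
    refine ⟨C, hC0, fun m => ?_⟩
    have h1 : ‖circleAverage (fun w => (p m w : ℂ) * φ w) 0 1‖ ≤
        circleAverage (fun w => p m w * ‖φ w‖) 0 1 := by
      unfold circleAverage
      rw [norm_smul, smul_eq_mul, Real.norm_of_nonneg (by positivity)]
      gcongr
      refine (intervalIntegral.norm_integral_le_integral_norm (by positivity)).trans (le_of_eq ?_)
      refine intervalIntegral.integral_congr fun θ _ => ?_
      simp only [norm_mul, norm_real]
      rw [Real.norm_of_nonneg (hp0 m _ (by simp))]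
    have i1 : CircleIntegrable (fun w => ε * p m w) 0 1 :=
      circleIntegrable_of_continuousOn zero_le_one ((hp m).const_smul ε)
    have i2 : CircleIntegrable (fun w => C * (p m w * T w)) 0 1 :=
      circleIntegrable_of_continuousOn zero_le_one (((hp m).mul hT).const_smul C)
    have h2 : circleAverage (fun w => p m w * ‖φ w‖) 0 1 ≤
        circleAverage (fun w => ε * p m w + C * (p m w * T w)) 0 1 := by
      refine Real.circleAverage_mono
        (circleIntegrable_of_continuousOn zero_le_one ((hp m).mul hφ.norm)) (i1.add i2) ?_
      intro w hw
      rw [abs_one] at hw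
      have := mul_le_mul_of_nonneg_left (hC w hw) (hp0 m w hw)
      linarith
    refine (h1.trans h2).trans (le_of_eq ?_)
    rw [Real.circleAverage_fun_add i1 i2]
    have e1 := Real.circleAverage_fun_smul (a := ε) (f := p m) (c := 0) (R := 1)
    have e2 := Real.circleAverage_fun_smul (a := C) (f := fun w => p m w * T w) (c := 0) (R := 1)
    simp only [smul_eq_mul] at e1 e2
    rw [e1, e2, hpc]
  rw [Metric.tendsto_atTop]
  intro δ hδ
  -- The `+ 1` covers a total mass `c` equal to zero.
  obtain ⟨C, hC0, hC⟩ := hbound (δ / (2 * (c + 1))) (by positivity)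
  have h3 : Tendsto (fun m => C * circleAverage (fun w => p m w * T w) 0 1) atTop (𝓝 (C * 0)) :=
    hlim.const_mul C
  rw [mul_zero] at h3
  obtain ⟨M, hM⟩ := eventually_atTop.1 (h3.eventually_lt_const (half_pos hδ))
  refine ⟨M, fun m hm => ?_⟩
  rw [dist_zero_right]
  have h4 : δ / (2 * (c + 1)) * c ≤ δ / 2 := by
    rw [div_mul_eq_mul_div, div_le_div_iff₀ (by positivity) (by positivity)]
    nlinarith
  linarith [hC m, hM m hm]

/-- Densities concentrating on a finite set have averages given by an atomic measure on it. -/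
lemma exists_weights_of_concentrated {p : ℕ → ℂ → ℝ} {T : ℂ → ℝ} {c : ℝ}
    (hp : ∀ m, ContinuousOn (p m) (sphere 0 1)) (hp0 : ∀ m, ∀ w ∈ sphere (0 : ℂ) 1, 0 ≤ p m w)
    (hpc : ∀ m, circleAverage (p m) 0 1 = c) (hT : ContinuousOn T (sphere 0 1))
    (hT0 : ∀ w ∈ sphere (0 : ℂ) 1, 0 ≤ T w)
    (hlim : Tendsto (fun m => circleAverage (fun w => p m w * T w) 0 1) atTop (𝓝 0))
    (Z : Finset ℂ) (hZ : ∀ w ∈ sphere (0 : ℂ) 1, T w = 0 → w ∈ Z) :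
    ∃ μ : ℂ → ℝ, (∀ β ∈ Z, 0 ≤ μ β) ∧ ∀ (φ : ℂ → ℂ) (ℓ : ℂ), ContinuousOn φ (sphere 0 1) →
      Tendsto (fun m => circleAverage (fun w => (p m w : ℂ) * φ w) 0 1) atTop (𝓝 ℓ) →
      ℓ = ∑ β ∈ Z, μ β * φ β := by
  -- Nonnegative continuous interpolation functions: `η β` is `1` at `β` and `0` at the other points
  -- of `Z`.
  set η : ℂ → ℂ → ℝ := fun β w => ∏ γ ∈ Z.erase β, (‖w - γ‖ / ‖β - γ‖) with hη
  have hηc : ∀ β, Continuous (η β) := fun β => by fun_prop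
  have hη0 : ∀ β w, 0 ≤ η β w := fun β w => Finset.prod_nonneg fun _ _ => by positivity
  have hηself : ∀ β, η β β = 1 := by
    intro β
    refine Finset.prod_eq_one fun γ hγ => div_self ?_
    rw [norm_ne_zero_iff, sub_ne_zero]
    exact (Finset.ne_of_mem_erase hγ).symm
  have hηne : ∀ β, ∀ γ ∈ Z, γ ≠ β → η β γ = 0 := by
    intro β γ hγ hne
    exact Finset.prod_eq_zero (Finset.mem_erase.2 ⟨hne, hγ⟩) (by simp)
  -- Along an ultrafilter all the bounded averages converge at once, so no subsequences are
  -- extracted. The weight at `β` is the limit of the averages of `η β`.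
  set U : Ultrafilter ℕ := Ultrafilter.of atTop
  have hU : (U : Filter ℕ) ≤ atTop := Ultrafilter.of_le _
  have hex : ∀ β, ∃ x : ℝ, 0 ≤ x ∧
      Tendsto (fun m => circleAverage (fun w => p m w * η β w) 0 1) U (𝓝 x) := by
    intro β
    obtain ⟨B, hB⟩ := (isCompact_sphere (0 : ℂ) 1).exists_bound_of_continuousOn
      (hηc β).continuousOn
    have hmem : ∀ m, circleAverage (fun w => p m w * η β w) 0 1 ∈ Icc 0 (B * c) := by
      intro m
      constructor
      · refine Real.circleAverage_nonneg_of_nonneg fun w hw => ?_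
        exact mul_nonneg (hp0 m w (by simpa using hw)) (hη0 β w)
      · have e1 := Real.circleAverage_fun_smul (a := B) (f := p m) (c := 0) (R := 1)
        simp only [smul_eq_mul] at e1
        rw [← hpc m, ← e1]
        refine Real.circleAverage_mono
          (circleIntegrable_of_continuousOn zero_le_one ((hp m).mul (hηc β).continuousOn))
          (circleIntegrable_of_continuousOn zero_le_one ((hp m).const_smul B)) fun w hw => ?_
        rw [abs_one] at hw
        rw [mul_comm]
        exact mul_le_mul_of_nonneg_right ((Real.le_norm_self _).trans (hB w hw)) (hp0 m w hw)
    have := (isCompact_Icc (a := 0) (b := B * c)).ultrafilter_le_nhds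
      (U.map fun m => circleAverage (fun w => p m w * η β w) 0 1)
      (by
        rw [le_principal_iff]
        exact Ultrafilter.mem_map.2 (univ_mem' hmem))
    obtain ⟨x, hx, hx'⟩ := this
    exact ⟨x, hx.1, hx'⟩
  choose μ hμ0 hμ using hex
  refine ⟨μ, fun β _ => hμ0 β, fun φ ℓ hφ hℓ => ?_⟩
  -- Subtracting the interpolant leaves a function vanishing on the zeros of `T`, whose averages
  -- tend to zero.
  set ψ : ℂ → ℂ := fun w => φ w - ∑ β ∈ Z, φ β * (η β w : ℂ) with hψ
  have hηc' : ∀ β, ContinuousOn (fun w => φ β * (η β w : ℂ)) (sphere 0 1) := fun β =>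
    (continuous_const.mul (continuous_ofReal.comp (hηc β))).continuousOn
  have hψc : ContinuousOn ψ (sphere 0 1) := hφ.sub (continuousOn_finsetSum _ fun β _ => hηc' β)
  have hψ0 : ∀ w ∈ sphere (0 : ℂ) 1, T w = 0 → ψ w = 0 := by
    intro w hw hTw
    have hwZ := hZ w hw hTw
    simp only [hψ]
    rw [Finset.sum_eq_single w, hηself]
    · simp
    · intro β hβ hne
      rw [hηne β w hwZ hne.symm]
      simp
    · exact fun h => absurd hwZ h
  have h1 := (tendsto_circleAverage_zero_of_concentrated hp hp0 hpc hT hT0 hlim hψc hψ0).mono_left hU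
  have hpC : ∀ m, ContinuousOn (fun w => (p m w : ℂ)) (sphere 0 1) := fun m =>
    continuous_ofReal.comp_continuousOn (hp m)
  have hsplit : ∀ m, circleAverage (fun w => (p m w : ℂ) * φ w) 0 1 =
      circleAverage (fun w => (p m w : ℂ) * ψ w) 0 1 +
        ∑ β ∈ Z, φ β * (circleAverage (fun w => p m w * η β w) 0 1 : ℝ) := by
    intro m
    have e : ∀ β, φ β * ((circleAverage (fun w => p m w * η β w) 0 1 : ℝ) : ℂ) =
        circleAverage (fun w => φ β * ((p m w * η β w : ℝ) : ℂ)) 0 1 := by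
      intro β
      have e1 := ofRealCLM.circleAverage_comp_comm (circleIntegrable_of_continuousOn zero_le_one
        ((hp m).mul (hηc β).continuousOn))
      have e2 := Real.circleAverage_fun_smul (a := φ β)
        (f := fun w => ((p m w * η β w : ℝ) : ℂ)) (c := 0) (R := 1)
      simp only [smul_eq_mul] at e2
      rw [e2]
      congr 1
      exact e1.symm
    have ic : ∀ β, CircleIntegrable (fun w => φ β * ((p m w * η β w : ℝ) : ℂ)) 0 1 := fun β =>
      circleIntegrable_of_continuousOn zero_le_one (continuousOn_const.mul
        (continuous_ofReal.comp_continuousOn ((hp m).mul (hηc β).continuousOn)))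
    have ic1 : CircleIntegrable (fun w => (p m w : ℂ) * ψ w) 0 1 :=
      circleIntegrable_of_continuousOn zero_le_one ((hpC m).mul hψc)
    have ic2 : CircleIntegrable (fun w => ∑ β ∈ Z, φ β * ((p m w * η β w : ℝ) : ℂ)) 0 1 :=
      circleIntegrable_of_continuousOn zero_le_one (continuousOn_finsetSum _ fun β _ =>
        continuousOn_const.mul
        (continuous_ofReal.comp_continuousOn ((hp m).mul (hηc β).continuousOn)))
    simp only [e]
    rw [← Real.circleAverage_fun_sum (fun β _ => ic β), ← Real.circleAverage_fun_add ic1 ic2]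
    congr 1
    funext w
    simp only [hψ, mul_sub, Finset.mul_sum]
    push_cast
    rw [eq_comm, sub_add_eq_add_sub, sub_eq_iff_eq_add]
    congr 1
    exact Finset.sum_congr rfl fun β _ => by ring
  have h2 : Tendsto (fun m => circleAverage (fun w => (p m w : ℂ) * φ w) 0 1) U
      (𝓝 (0 + ∑ β ∈ Z, φ β * (μ β : ℂ))) := by
    simp only [hsplit]
    refine h1.add (tendsto_finsetSum _ fun β _ => ?_)
    exact ((continuous_ofReal.tendsto _).comp (hμ β)).const_mul _
  have h3 := tendsto_nhds_unique (hℓ.mono_left hU) h2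
  rw [h3, zero_add]
  exact Finset.sum_congr rfl fun β _ => mul_comm _ _

/-! ### Fubini on two circles and the trigonometric polynomial of the kernel -/

lemma circleAverage_swap {F : ℂ → ℂ → ℂ} {r s : ℝ} (hr : 0 ≤ r) (hs : 0 ≤ s)
    (hF : ContinuousOn (Function.uncurry F) (sphere 0 r ×ˢ sphere 0 s)) :
    circleAverage (fun w => circleAverage (fun z => F w z) 0 s) 0 r =
      circleAverage (fun z => circleAverage (fun w => F w z) 0 r) 0 s := by
  have hc : Continuous (Function.uncurry fun θ t : ℝ => F (circleMap 0 r θ) (circleMap 0 s t)) := by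
    have : Continuous fun x : ℝ × ℝ => (circleMap 0 r x.1, circleMap 0 s x.2) := by fun_prop
    exact hF.comp_continuous this fun x => ⟨circleMap_mem_sphere 0 hr _, circleMap_mem_sphere 0 hs _⟩
  unfold circleAverage
  simp only [intervalIntegral.integral_smul]
  congr 2
  refine MeasureTheory.intervalIntegral_intervalIntegral_swap ?_
  exact (hc.continuousOn.integrableOn_compact (isCompact_uIcc.prod isCompact_uIcc)).mono_set
    (prod_mono uIoc_subset_uIcc uIoc_subset_uIcc)

lemma taylorCoeffZero_sum {ι : Type*} (s : Finset ι) {F : ι → ℂ → ℂ}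
    (hF : ∀ i ∈ s, DifferentiableOn ℂ (F i) (ball 0 1)) (n : ℕ) :
    taylorCoeffZero n (fun z => ∑ i ∈ s, F i z) = ∑ i ∈ s, taylorCoeffZero n (F i) := by
  classical
  induction s using Finset.induction_on with
  | empty => simp [taylorCoeffZero]
  | insert i s his ih =>
    simp only [Finset.sum_insert his]
    have h1 : DifferentiableOn ℂ (fun z => ∑ j ∈ s, F j z) (ball 0 1) :=
      DifferentiableOn.fun_sum fun j hj => hF j (Finset.mem_insert_of_mem hj)
    rw [taylorCoeffZero_add (hF i (Finset.mem_insert_self _ _)) h1,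
      ih fun j hj => hF j (Finset.mem_insert_of_mem hj)]

/-- The `n`th coefficient of `f` times the kernel is a polynomial in the pole parameter. -/
lemma taylorCoeffZero_mul_halfPlaneMap {f : ℂ → ℂ} (hf : DifferentiableOn ℂ f (ball 0 1)) {α : ℂ}
    (hα : ‖α‖ = 1) (n : ℕ) :
    (taylorCoeffZero n fun z => f z * halfPlaneMap α z) =
      -taylorCoeffZero n f +
        ∑ k ∈ Finset.range (n + 1), 2 * α ^ k * taylorCoeffZero (n - k) f := by
  have hs : DifferentiableOn ℂ (fun z => 2 * α ^ (n + 1) * f z / (1 - α * z)) (ball 0 1) :=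
    DifferentiableOn.div (by fun_prop) (by fun_prop) fun z hz => one_sub_mul_ne_zero hα hz
  -- With `u = αz`: `(1 + u)/(1 - u) = -1 + 2 ∑_{k ≤ n} u^k + 2u^(n+1)/(1 - u)`, and the last term
  -- has too high an order to matter.
  have heq : EqOn (fun z => f z * halfPlaneMap α z) (fun z => ((-1) * f z +
      ∑ k ∈ Finset.range (n + 1), 2 * α ^ k * (z ^ k * f z)) +
      z ^ (n + 1) * (2 * α ^ (n + 1) * f z / (1 - α * z))) (ball 0 1) := by
    intro z hz
    have hne := one_sub_mul_ne_zero hα hz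
    have hg := mul_neg_geom_sum (α * z) (n + 1)
    have h1 : ∑ k ∈ Finset.range (n + 1), 2 * α ^ k * (z ^ k * f z) =
        2 * f z * ∑ k ∈ Finset.range (n + 1), (α * z) ^ k := by
      rw [Finset.mul_sum]
      exact Finset.sum_congr rfl fun k _ => by rw [mul_pow]; ring
    have h2 : ∑ k ∈ Finset.range (n + 1), (α * z) ^ k = (1 - (α * z) ^ (n + 1)) / (1 - α * z) := by
      rw [eq_div_iff hne, mul_comm, hg]
    simp only [h1, h2, halfPlaneMap]
    field_simp
    ring
  have hterm : ∀ k ∈ Finset.range (n + 1),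
      DifferentiableOn ℂ (fun z => 2 * α ^ k * (z ^ k * f z)) (ball 0 1) := fun k _ => by fun_prop
  have hz : DifferentiableOn ℂ (fun z => z ^ (n + 1) * (2 * α ^ (n + 1) * f z / (1 - α * z)))
      (ball 0 1) := DifferentiableOn.mul (by fun_prop) hs
  rw [taylorCoeffZero_congr heq, taylorCoeffZero_add (by fun_prop) hz,
    taylorCoeffZero_add (by fun_prop) (by fun_prop), taylorCoeffZero_sum _ hterm,
    taylorCoeffZero_const_mul hf, taylorCoeffZero_pow_mul_eq_zero hs (Nat.lt_succ_self n)]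
  rw [add_zero, neg_one_mul]
  congr 1
  refine Finset.sum_congr rfl fun k hk => ?_
  rw [taylorCoeffZero_const_mul (by fun_prop), taylorCoeffZero_pow_mul hf
    (by simpa [Nat.lt_succ_iff] using hk)]

/-- On the circle twice the real part, multiplied by `w ^ n`, is a polynomial in `w`. Its constant
term `2 a_0` comes from `k = n` alone, so it is not the zero polynomial. -/
lemma re_sum_pow_inv_zeros_finite {n : ℕ} (hn : 1 ≤ n) {a : ℕ → ℂ} (h0 : a 0 ≠ 0) :
    {w : ℂ | ‖w‖ = 1 ∧
      (-a n + ∑ k ∈ Finset.range (n + 1), 2 * (w⁻¹) ^ k * a (n - k)).re = 0}.Finite := by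
  set Q : Polynomial ℂ := Polynomial.X ^ n * Polynomial.C (-a n - conj (a n)) +
    ∑ k ∈ Finset.range (n + 1), (Polynomial.X ^ (n - k) * Polynomial.C (2 * a (n - k)) +
      Polynomial.X ^ (n + k) * Polynomial.C (2 * conj (a (n - k)))) with hQ
  have hQ0 : Q.eval 0 = 2 * a 0 := by
    simp only [hQ, Polynomial.eval_add, Polynomial.eval_mul, Polynomial.eval_pow,
      Polynomial.eval_X, Polynomial.eval_C, Polynomial.eval_finsetSum]
    rw [Finset.sum_eq_single n]
    · simp [show n ≠ 0 by omega]
    · intro k hk hkn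
      have : n - k ≠ 0 := by
        rw [Finset.mem_range] at hk
        omega
      simp [this, show n ≠ 0 by omega]
    · simp
  have hQne : Q ≠ 0 := by
    intro h
    rw [h] at hQ0
    simp [h0] at hQ0
  refine (Q.rootSet_finite ℂ).subset ?_
  rintro w ⟨hw, hre⟩
  rw [Polynomial.mem_rootSet_of_ne hQne, Polynomial.coe_aeval_eq_eval]
  have hw0 : w ≠ 0 := by
    rintro rfl
    simp at hw
  have hcw : conj (w⁻¹) = w := by
    rw [Complex.inv_def, normSq_eq_norm_sq, hw]
    simp
  set P := -a n + ∑ k ∈ Finset.range (n + 1), 2 * (w⁻¹) ^ k * a (n - k) with hP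
  have hPc : P + conj P = 0 := by
    rw [add_conj, hre]
    simp
  have hconj : conj P = -conj (a n) + ∑ k ∈ Finset.range (n + 1), 2 * w ^ k * conj (a (n - k)) := by
    rw [hP]
    simp only [map_add, map_neg, map_sum, map_mul, map_pow, hcw,
      Complex.conj_ofNat]
  have : Q.eval w = w ^ n * (P + conj P) := by
    rw [hconj, hP]
    simp only [hQ, Polynomial.eval_add, Polynomial.eval_mul, Polynomial.eval_pow,
      Polynomial.eval_X, Polynomial.eval_C, Polynomial.eval_finsetSum]
    have e : ∀ x y z t : ℂ, x + y + (z + t) = (x + z) + (y + t) := by intros; ring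
    rw [e (-a n), ← Finset.sum_add_distrib, mul_add, Finset.mul_sum, sub_eq_add_neg]
    congr 1
    refine Finset.sum_congr rfl fun k hk => ?_
    obtain ⟨j, rfl⟩ := Nat.exists_eq_add_of_le (show k ≤ n by
      rw [Finset.mem_range] at hk
      omega)
    rw [show k + j - k = j by omega, pow_add, pow_add]
    have hkk : w ^ k * w⁻¹ ^ k = 1 := by rw [← mul_pow, mul_inv_cancel₀ hw0, one_pow]
    linear_combination (-2 * w ^ j * a j) * hkk
  rw [this, hPc, mul_zero]

/-! ### Consequences of extremality -/

lemma KrzyzClass.mul_exp_neg {f h : ℂ → ℂ} (hf : KrzyzClass f)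
    (hh : DifferentiableOn ℂ h (ball 0 1)) (hre : ∀ z ∈ ball (0 : ℂ) 1, 0 ≤ (h z).re) {ε : ℝ}
    (hε : 0 ≤ ε) : KrzyzClass fun z => f z * exp (-(ε * h z)) := by
  have hfd := hf.1
  refine ⟨by fun_prop, fun z hz => ?_⟩
  have h1 := hf.2 z hz
  have h2 : ‖exp (-(ε * h z))‖ ≤ 1 := by
    rw [norm_exp, Real.exp_le_one_iff, neg_re, re_ofReal_mul]
    have := mul_nonneg hε (hre z hz)
    linarith
  rw [norm_mul]
  refine ⟨mul_pos h1.1 (norm_pos_iff.2 (exp_ne_zero _)), ?_⟩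
  exact mul_le_one₀ h1.2 (norm_nonneg _) h2

lemma IsExtremalFor.re_taylorCoeffZero_mul_nonneg_of_re_nonneg {n : ℕ} {f h : ℂ → ℂ}
    (hf : IsExtremalFor n f) (hh : DifferentiableOn ℂ h (ball 0 1))
    (hre : ∀ z ∈ ball (0 : ℂ) 1, 0 ≤ (h z).re) :
    0 ≤ (taylorCoeffZero n fun z => f z * h z).re :=
  hf.re_taylorCoeffZero_mul_nonneg hh fun _ hε _ => hf.1.mul_exp_neg hh hre hε

/-- Variation by the constants `I` and `-I`, that is, by rotations of `f`. -/
lemma IsExtremalFor.im_taylorCoeffZero_eq_zero {n : ℕ} {f : ℂ → ℂ} (hf : IsExtremalFor n f) :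
    (taylorCoeffZero n f).im = 0 := by
  have hfd := hf.1.1
  have h1 := hf.re_taylorCoeffZero_mul_nonneg_of_re_nonneg (h := fun _ => I) (by fun_prop) (by simp)
  have h2 := hf.re_taylorCoeffZero_mul_nonneg_of_re_nonneg (h := fun _ => -I) (by fun_prop) (by simp)
  simp only [mul_comm (f _)] at h1 h2
  rw [taylorCoeffZero_const_mul hfd] at h1 h2
  simp at h1 h2
  linarith

/-- Both `g` and `-g` are admissible directions, because `f exp (εg) = exp (-(1 - ε)g)` stays in the
class for `ε ≤ 1`. The two inequalities give equality. -/
lemma IsExtremalFor.re_taylorCoeffZero_mul_log_eq_zero {n : ℕ} {f g : ℂ → ℂ}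
    (hf : IsExtremalFor n f) (hg : DifferentiableOn ℂ g (ball 0 1))
    (hre : ∀ z ∈ ball (0 : ℂ) 1, 0 ≤ (g z).re)
    (hfg : ∀ z ∈ ball (0 : ℂ) 1, f z = exp (-g z)) :
    (taylorCoeffZero n fun z => f z * g z).re = 0 := by
  have hfd := hf.1.1
  have h1 := hf.re_taylorCoeffZero_mul_nonneg_of_re_nonneg hg hre
  have h2 := hf.re_taylorCoeffZero_mul_nonneg (h := fun z => -g z) (by fun_prop) (by
    intro ε h0 h1
    refine ⟨by fun_prop, fun z hz => ?_⟩
    beta_reduce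
    rw [hfg z hz, ← Complex.exp_add, norm_exp]
    refine ⟨Real.exp_pos _, ?_⟩
    rw [Real.exp_le_one_iff]
    have := mul_nonneg (sub_nonneg.2 h1) (hre z hz)
    have e : (-g z + -(ε * -g z)).re = -((1 - ε) * (g z).re) := by
      simp
      ring
    rw [e]
    linarith)
  have e : (fun z => f z * -g z) = fun z => (-1) * (f z * g z) := by
    funext z
    ring
  rw [e, taylorCoeffZero_const_mul (by fun_prop)] at h2
  simp at h2
  linarith

/-! ### Extremal functions are atomic -/

lemma tendsto_one_sub_one_div : Tendsto (fun m : ℕ => 1 - 1 / ((m : ℝ) + 2)) atTop (𝓝 1) := by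
  have h1 : Tendsto (fun m : ℕ => 1 / ((m : ℝ) + 2)) atTop (𝓝 0) :=
    tendsto_const_nhds.div_atTop
      (tendsto_atTop_add_const_right _ _ tendsto_natCast_atTop_atTop)
  have h2 := h1.const_sub 1
  rwa [sub_zero] at h2

lemma one_sub_one_div_mem (m : ℕ) :
    1 / 2 ≤ 1 - 1 / ((m : ℝ) + 2) ∧ 1 - 1 / ((m : ℝ) + 2) < 1 := by
  have h1 : 1 / ((m : ℝ) + 2) ≤ 1 / 2 :=
    one_div_le_one_div_of_le two_pos (by linarith [(Nat.cast_nonneg m : (0 : ℝ) ≤ m)])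
  have h2 : 0 < 1 / ((m : ℝ) + 2) := by positivity
  constructor <;> linarith

/-- Every extremal function is an atomic singular inner function with finitely many atoms. -/
theorem IsExtremalFor.exists_isAtomicSingularInner {n : ℕ} {f : ℂ → ℂ} (hn : 1 ≤ n)
    (hf : IsExtremalFor n f) :
    ∃ (N : ℕ) (ζ : ℂ) (w : Fin N → ℝ) (α : Fin N → ℂ), IsAtomicSingularInner f N ζ w α := by
  obtain ⟨g, hgd, hgre, hfg⟩ := hf.1.exists_log
  have hfd := hf.1.1
  -- Since `g` need not have boundary values, it is replaced by the dilates `g (r m * w)`,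
  -- continuous on the closed disc.
  set r : ℕ → ℝ := fun m => 1 - 1 / ((m : ℝ) + 2) with hr
  have hr0 : ∀ m, 0 < r m := fun m => one_half_pos.trans_le (one_sub_one_div_mem m).1
  have hr1 : ∀ m, r m < 1 := fun m => (one_sub_one_div_mem m).2
  have hrlim : Tendsto r atTop (𝓝 1) := tendsto_one_sub_one_div
  have hmul : ∀ m, ∀ w ∈ closedBall (0 : ℂ) 1, (r m : ℂ) * w ∈ ball (0 : ℂ) 1 := by
    intro m w hw
    rw [mem_closedBall_zero_iff] at hw
    rw [mem_ball_zero_iff, norm_mul, norm_real, Real.norm_of_nonneg (hr0 m).le]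
    nlinarith [hr0 m, hr1 m, norm_nonneg w]
  set G : ℕ → ℂ → ℂ := fun m w => g (r m * w) with hG
  have hGd : ∀ m, DiffContOnCl ℂ (G m) (ball 0 1) := by
    intro m
    apply DifferentiableOn.diffContOnCl
    rw [closure_ball _ one_ne_zero]
    exact hgd.comp (by fun_prop) (hmul m)
  have hG0 : ∀ m, G m 0 = g 0 := fun m => by simp [hG]
  have hGc : ∀ m, ContinuousOn (G m) (sphere 0 1) := fun m => by
    refine (hGd m).continuousOn.mono ?_
    rw [closure_ball _ one_ne_zero]
    exact sphere_subset_closedBall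
  set p : ℕ → ℂ → ℝ := fun m w => (G m w).re with hp
  have hpc : ∀ m, ContinuousOn (p m) (sphere 0 1) := fun m =>
    continuous_re.comp_continuousOn (hGc m)
  have hp0 : ∀ m, ∀ w ∈ sphere (0 : ℂ) 1, 0 ≤ p m w := fun m w hw =>
    hgre _ (hmul m w (sphere_subset_closedBall hw))
  have hpavg : ∀ m, circleAverage (p m) 0 1 = (g 0).re := by
    intro m
    rw [← hG0 m, ← DiffContOnCl.circleAverage (R := 1) (f := G m) (c := 0) (by simpa using hGd m)]
    exact circleAverage_re (circleIntegrable_of_continuousOn zero_le_one (hGc m))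
  set a : ℕ → ℂ := fun k => taylorCoeffZero k f with ha
  set T : ℂ → ℝ := fun w => (taylorCoeffZero n fun z => f z * halfPlaneMap w⁻¹ z).re with hTdef
  have hinv : ∀ w ∈ sphere (0 : ℂ) 1, ‖w⁻¹‖ = 1 := fun w hw => by
    rw [norm_inv, mem_sphere_zero_iff_norm.1 hw, inv_one]
  have hsph0 : ∀ w ∈ sphere (0 : ℂ) 1, w ≠ 0 := by
    rintro w hw rfl
    simp at hw
  have hTeq : ∀ w ∈ sphere (0 : ℂ) 1, T w =
      (-a n + ∑ k ∈ Finset.range (n + 1), 2 * (w⁻¹) ^ k * a (n - k)).re := fun w hw => by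
    rw [hTdef]
    simp only
    rw [taylorCoeffZero_mul_halfPlaneMap hfd (hinv w hw)]
  have hTc : ContinuousOn T (sphere 0 1) := by
    refine ContinuousOn.congr ?_ hTeq
    refine continuous_re.comp_continuousOn (continuousOn_const.add
      (continuousOn_finsetSum _ fun k _ => ?_))
    exact (continuousOn_const.mul ((continuousOn_id.inv₀ hsph0).pow k)).mul continuousOn_const
  have hT0 : ∀ w ∈ sphere (0 : ℂ) 1, 0 ≤ T w := fun w hw =>
    hf.re_taylorCoeffZero_mul_nonneg_of_re_nonneg (differentiableOn_halfPlaneMap (hinv w hw))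
      fun z hz => re_halfPlaneMap_nonneg (hinv w hw) hz
  have ha0 : a 0 ≠ 0 := by
    simp only [ha, taylorCoeffZero, iteratedDeriv_zero, Nat.factorial_zero, Nat.cast_one, div_one]
    exact norm_pos_iff.1 (hf.1.2 0 (mem_ball_self one_pos)).1
  have hfin := re_sum_pow_inv_zeros_finite hn ha0
  set Z := hfin.toFinset with hZdef
  have hZ : ∀ w ∈ sphere (0 : ℂ) 1, T w = 0 → w ∈ Z := by
    intro w hw h
    rw [hTeq w hw] at h
    rw [hZdef, Set.Finite.mem_toFinset]
    exact ⟨by simpa using hw, h⟩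
  have hZs : ∀ w ∈ Z, w ∈ sphere (0 : ℂ) 1 := by
    intro w hw
    rw [hZdef, Set.Finite.mem_toFinset] at hw
    simpa using hw.1
  have hhalf : sphere (0 : ℂ) (1 / 2) ⊆ ball 0 1 :=
    sphere_subset_closedBall.trans (closedBall_subset_ball (by norm_num))
  -- Exchanging the average over the pole `w` with the Cauchy integral in `z` turns the average of
  -- `p m * T` into a coefficient, by the Schwarz formula.
  have hfubini : ∀ m, circleAverage (fun w => p m w * T w) 0 1 =
      (taylorCoeffZero n fun z => f z * (G m z - (g 0).im * I)).re := by
    intro m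
    have hGm : DifferentiableOn ℂ (G m) (ball 0 1) := (hGd m).differentiableOn
    have hF : ContinuousOn (Function.uncurry fun w z : ℂ =>
        f z / z ^ n * (halfPlaneMap w⁻¹ z * (p m w : ℂ))) (sphere 0 1 ×ˢ sphere 0 (1 / 2)) := by
      have c1 : ContinuousOn (fun x : ℂ × ℂ => f x.2) (sphere 0 1 ×ˢ sphere 0 (1 / 2)) :=
        hfd.continuousOn.comp continuousOn_snd fun x hx => hhalf hx.2
      have c2 : ContinuousOn (fun x : ℂ × ℂ => (p m x.1 : ℂ)) (sphere 0 1 ×ˢ sphere 0 (1 / 2)) :=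
        continuous_ofReal.comp_continuousOn ((hpc m).comp continuousOn_fst fun x hx => hx.1)
      have c3 : ContinuousOn (fun x : ℂ × ℂ => x.1⁻¹ * x.2) (sphere 0 1 ×ˢ sphere 0 (1 / 2)) :=
        (continuousOn_fst.inv₀ fun x hx => hsph0 _ hx.1).mul continuousOn_snd
      refine (c1.div (continuousOn_snd.pow n) fun x hx => ?_).mul (ContinuousOn.mul ?_ c2)
      · refine pow_ne_zero _ fun h => ?_
        have := hx.2
        rw [h] at this
        simp at this
      · exact (continuousOn_const.add c3).div (continuousOn_const.sub c3) fun x hx =>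
          one_sub_mul_ne_zero (hinv _ hx.1) (hhalf hx.2)
    have hsw := circleAverage_swap zero_le_one (by norm_num) hF
    have hL : circleAverage (fun w => circleAverage (fun z =>
        f z / z ^ n * (halfPlaneMap w⁻¹ z * (p m w : ℂ))) 0 (1 / 2)) 0 1 =
        circleAverage (fun w => (p m w : ℂ) *
          taylorCoeffZero n fun z => f z * halfPlaneMap w⁻¹ z) 0 1 := by
      refine circleAverage_congr_sphere fun w hw => ?_
      rw [abs_one] at hw
      have hk := differentiableOn_halfPlaneMap (hinv w hw)
      rw [taylorCoeffZero_eq_circleAverage (hfd.fun_mul hk) (r := 1 / 2) (by norm_num) (by norm_num),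
        ← smul_eq_mul, ← Real.circleAverage_fun_smul]
      congr 1
      funext z
      simp only [smul_eq_mul]
      ring
    have hR : circleAverage (fun z => circleAverage (fun w =>
        f z / z ^ n * (halfPlaneMap w⁻¹ z * (p m w : ℂ))) 0 1) 0 (1 / 2) =
        taylorCoeffZero n fun z => f z * (G m z - (g 0).im * I) := by
      rw [taylorCoeffZero_eq_circleAverage (by fun_prop) (r := 1 / 2) (by norm_num) (by norm_num)]
      refine circleAverage_congr_sphere fun z hz => ?_
      rw [abs_of_pos (by norm_num)] at hz
      have e := Real.circleAverage_fun_smul (a := f z / z ^ n)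
        (f := fun w => halfPlaneMap w⁻¹ z * (p m w : ℂ)) (c := 0) (R := 1)
      simp only [smul_eq_mul] at e
      rw [e, circleAverage_halfPlaneMap_mul_re (hGd m) (hhalf hz), hG0]
      ring
    rw [hL, hR] at hsw
    rw [← hsw, ← circleAverage_re]
    · congr 1
      funext w
      rw [re_ofReal_mul]
    · refine circleIntegrable_of_continuousOn zero_le_one
        ((continuous_ofReal.comp_continuousOn (hpc m)).mul ?_)
      refine ContinuousOn.congr ?_ fun w hw => taylorCoeffZero_mul_halfPlaneMap hfd (hinv w hw) n
      refine continuousOn_const.add (continuousOn_finsetSum _ fun k _ => ?_)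
      exact (continuousOn_const.mul ((continuousOn_id.inv₀ hsph0).pow k)).mul continuousOn_const
  have hlimcoef : Tendsto (fun m => taylorCoeffZero n fun z => f z * (G m z - (g 0).im * I)) atTop
      (𝓝 (taylorCoeffZero n fun z => f z * (g z - (g 0).im * I))) := by
    have huc : UniformContinuousOn g (closedBall (0 : ℂ) (1 / 2)) :=
      (isCompact_closedBall _ _).uniformContinuousOn_of_continuous
        (hgd.continuousOn.mono (closedBall_subset_ball (by norm_num)))
    rw [Metric.uniformContinuousOn_iff] at huc
    rw [Metric.tendsto_atTop]
    intro ε hε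
    obtain ⟨δ, hδ, hδ'⟩ := huc (ε / (2 * 2 ^ n)) (by positivity)
    obtain ⟨M, hM⟩ := Metric.tendsto_atTop.1 hrlim δ hδ
    refine ⟨M, fun m hm => ?_⟩
    have hGm : DifferentiableOn ℂ (G m) (ball 0 1) := (hGd m).differentiableOn
    have e : (fun z => f z * (G m z - (g 0).im * I)) =
        fun z => f z * (g z - (g 0).im * I) + f z * (G m z - g z) := by
      funext z
      ring
    rw [e, taylorCoeffZero_add (by fun_prop) (by fun_prop), dist_self_add_left]
    refine (norm_taylorCoeffZero_le (C := ε / (2 * 2 ^ n)) (by fun_prop) (fun z hz => ?_) n).trans_lt ?_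
    · have hz2 : ‖z‖ = 1 / 2 := by simpa using hz
      have h1 : dist (g (r m * z)) (g z) < ε / (2 * 2 ^ n) := by
        refine hδ' _ ?_ _ ?_ ?_
        · rw [mem_closedBall_zero_iff, norm_mul, norm_real, Real.norm_of_nonneg (hr0 m).le, hz2]
          nlinarith [hr1 m]
        · rw [mem_closedBall_zero_iff, hz2]
        · have h2 : dist ((r m : ℂ) * z) z = dist (r m) 1 * ‖z‖ := by
            rw [dist_eq_norm, show (r m : ℂ) * z - z = ((r m - 1 : ℝ) : ℂ) * z by push_cast; ring,
              norm_mul, norm_real, Real.dist_eq, Real.norm_eq_abs]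
          rw [h2, hz2]
          have := hM m hm
          have := dist_nonneg (x := r m) (y := 1)
          linarith
      rw [norm_mul]
      rw [dist_eq_norm] at h1
      calc ‖f z‖ * ‖G m z - g z‖ ≤ 1 * (ε / (2 * 2 ^ n)) := by
            gcongr
            exact (hf.1.2 z (hhalf hz)).2
        _ = _ := one_mul _
    · field_simp
      norm_num
  have hlimT : Tendsto (fun m => circleAverage (fun w => p m w * T w) 0 1) atTop (𝓝 0) := by
    simp only [hfubini]
    -- The part with `g` vanishes by the two-sided variation; the imaginary constant contributes
    -- nothing because `a_n` is real.
    have h0 : (taylorCoeffZero n fun z => f z * (g z - (g 0).im * I)).re = 0 := by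
      have e : (fun z => f z * (g z - (g 0).im * I)) =
          fun z => f z * g z + (-((g 0).im * I)) * f z := by
        funext z
        ring
      rw [e, taylorCoeffZero_add (by fun_prop) (by fun_prop), taylorCoeffZero_const_mul hfd, add_re,
        hf.re_taylorCoeffZero_mul_log_eq_zero hgd hgre hfg, mul_re]
      simp [hf.im_taylorCoeffZero_eq_zero]
    rw [← h0]
    exact (continuous_re.tendsto _).comp hlimcoef
  obtain ⟨μ, hμ0, hμ⟩ := exists_weights_of_concentrated hpc hp0 hpavg hTc hT0 hlimT Z hZ
  have hrep : ∀ z ∈ ball (0 : ℂ) 1, g z - (g 0).im * I = ∑ β ∈ Z, μ β * halfPlaneMap β⁻¹ z := by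
    intro z hz
    refine hμ (fun w => halfPlaneMap w⁻¹ z) _ ?_ ?_
    · have c3 : ContinuousOn (fun w : ℂ => w⁻¹ * z) (sphere 0 1) :=
        (continuousOn_id.inv₀ hsph0).mul continuousOn_const
      exact (continuousOn_const.add c3).div (continuousOn_const.sub c3) fun w hw =>
          one_sub_mul_ne_zero (hinv _ hw) hz
    · have e : ∀ m, circleAverage (fun w => (p m w : ℂ) * halfPlaneMap w⁻¹ z) 0 1 =
          G m z - (g 0).im * I := by
        intro m
        rw [← hG0 m, ← circleAverage_halfPlaneMap_mul_re (hGd m) hz]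
        congr 1
        funext w
        rw [mul_comm]
      simp only [e]
      refine Tendsto.sub_const ?_ _
      have h1 : Tendsto (fun m => (r m : ℂ) * z) atTop (𝓝 z) := by
        have := ((continuous_ofReal.tendsto 1).comp hrlim).mul_const z
        simpa using this
      exact ((hgd.differentiableAt (isOpen_ball.mem_nhds hz)).continuousAt.tendsto).comp h1
  -- Zeros of `T` carrying no mass are dropped, so that all weights are positive. An atom at the
  -- pole `β` has parameter `α = β⁻¹`.
  set Z' := Z.filter fun β => 0 < μ β with hZ'
  let e := Z'.equivFin.symm
  refine ⟨Z'.card, exp (-((g 0).im * I)), fun j => μ (e j), fun j => ((e j : ℂ))⁻¹, ?_, ?_, ?_, ?_, ?_⟩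
  · rw [show -(((g 0).im : ℂ) * I) = ((-(g 0).im : ℝ) : ℂ) * I by push_cast; ring,
      norm_exp_ofReal_mul_I]
  · intro j
    exact (Finset.mem_filter.1 (e j).2).2
  · intro j
    exact hinv _ (hZs _ (Finset.mem_filter.1 (e j).2).1)
  · intro i j hij
    exact e.injective (Subtype.ext (inv_injective hij))
  · intro z hz
    rw [hfg z hz, ← Complex.exp_add]
    congr 1
    have h1 : ∑ j, (μ (e j) : ℂ) * ((1 + (e j : ℂ)⁻¹ * z) / (1 - (e j : ℂ)⁻¹ * z)) =
        ∑ β ∈ Z, μ β * halfPlaneMap β⁻¹ z := by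
      rw [e.sum_comp (fun β : Z' => (μ β : ℂ) * ((1 + (β : ℂ)⁻¹ * z) / (1 - (β : ℂ)⁻¹ * z))),
        Finset.sum_coe_sort Z' (fun β : ℂ => (μ β : ℂ) * ((1 + β⁻¹ * z) / (1 - β⁻¹ * z))), hZ',
        Finset.sum_filter]
      refine Finset.sum_congr rfl fun β hβ => ?_
      split_ifs with h
      · rfl
      · rw [le_antisymm (not_lt.1 h) (hμ0 β hβ)]
        simp
    rw [h1, ← hrep z hz]
    ring

/-! ### Oscillatory integrals -/

lemma continuousOn_of_forall_hasDerivAt {f f' : ℝ → ℝ} {s : Set ℝ}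
    (h : ∀ x ∈ s, HasDerivAt f (f' x) x) : ContinuousOn f s :=
  fun x hx => (h x hx).continuousAt.continuousWithinAt

/-- First derivative test of van der Corput for an increasing derivative. -/
lemma norm_integral_exp_le_of_deriv {Ψ h k : ℝ → ℝ} {p q δ : ℝ} (hpq : p ≤ q) (hδ : 0 < δ)
    (hΨ : ∀ x ∈ Icc p q, HasDerivAt Ψ (h x) x) (hh : ∀ x ∈ Icc p q, HasDerivAt h (k x) x)
    (hk : ContinuousOn k (Icc p q)) (hk0 : ∀ x ∈ Icc p q, 0 ≤ k x)
    (hb : (∀ x ∈ Icc p q, δ ≤ h x) ∨ ∀ x ∈ Icc p q, h x ≤ -δ) :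
    ‖∫ x in p..q, exp (Ψ x * I)‖ ≤ 2 / δ := by
  have hne : ∀ x ∈ Icc p q, h x ≠ 0 := by
    rintro x hx h0
    rcases hb with hb | hb
    · linarith [hb x hx]
    · linarith [hb x hx]
  have hu : uIcc p q = Icc p q := uIcc_of_le hpq
  have hhc : ContinuousOn h (Icc p q) := continuousOn_of_forall_hasDerivAt hh
  have hΨc : ContinuousOn Ψ (Icc p q) := continuousOn_of_forall_hasDerivAt hΨ
  have hinv : ∀ x ∈ uIcc p q, HasDerivAt (fun x => (((h x)⁻¹ : ℝ) : ℂ))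
      (((-k x / h x ^ 2 : ℝ)) : ℂ) x := fun x hx => by
    rw [hu] at hx
    exact ((hh x hx).fun_inv (hne x hx)).ofReal_comp
  have hexp : ∀ x ∈ uIcc p q, HasDerivAt (fun x => exp (Ψ x * I))
      (exp (Ψ x * I) * (h x * I)) x := fun x hx => by
    rw [hu] at hx
    exact ((hΨ x hx).ofReal_comp.mul_const I).cexp
  have hquot : ContinuousOn (fun x => -k x / h x ^ 2) (Icc p q) :=
    hk.neg.div (hhc.pow 2) fun x hx => pow_ne_zero _ (hne x hx)
  have hexpc : ContinuousOn (fun x => exp (Ψ x * I)) (Icc p q) :=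
    continuous_exp.comp_continuousOn
      ((continuous_ofReal.comp_continuousOn hΨc).mul continuousOn_const)
  have hdexpc : ContinuousOn (fun x => exp (Ψ x * I) * (h x * I)) (Icc p q) :=
    hexpc.mul ((continuous_ofReal.comp_continuousOn hhc).mul continuousOn_const)
  -- Integration by parts of `h⁻¹` against the derivative of `exp (iΨ)`; as `h` is monotone, the
  -- variation of `h⁻¹` is just `(h p)⁻¹ - (h q)⁻¹`.
  have hibp := intervalIntegral.integral_mul_deriv_eq_deriv_mul hinv hexp
    ((continuous_ofReal.comp_continuousOn hquot).intervalIntegrable_of_Icc hpq)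
    (hdexpc.intervalIntegrable_of_Icc hpq)
  have hL : ∫ x in p..q, (((h x)⁻¹ : ℝ) : ℂ) * (exp (Ψ x * I) * (h x * I)) =
      (∫ x in p..q, exp (Ψ x * I)) * I := by
    rw [← intervalIntegral.integral_mul_const]
    refine intervalIntegral.integral_congr fun x hx => ?_
    rw [hu] at hx
    have : (h x : ℂ) ≠ 0 := ofReal_ne_zero.2 (hne x hx)
    push_cast
    field_simp
  have hvar : ∫ x in p..q, k x / h x ^ 2 = (h p)⁻¹ - (h q)⁻¹ := by
    have := intervalIntegral.integral_eq_sub_of_hasDerivAt (a := p) (b := q)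
      (f := fun x => -(h x)⁻¹) (f' := fun x => k x / h x ^ 2) (fun x hx => by
        rw [hu] at hx
        have h1 := ((hh x hx).fun_inv (hne x hx)).fun_neg
        rwa [neg_div, neg_neg] at h1) (by
        refine ContinuousOn.intervalIntegrable_of_Icc hpq ?_
        exact hk.div (hhc.pow 2) fun x hx => pow_ne_zero _ (hne x hx))
    rw [this]
    ring
  have hR : ‖∫ x in p..q, ((-k x / h x ^ 2 : ℝ) : ℂ) * exp (Ψ x * I)‖ ≤ (h p)⁻¹ - (h q)⁻¹ := by
    rw [← hvar]
    refine intervalIntegral.norm_integral_le_of_norm_le hpq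
      (Eventually.of_forall fun x hx => ?_) ?_
    · rw [norm_mul, norm_exp_ofReal_mul_I, mul_one, norm_real, neg_div, norm_neg, Real.norm_of_nonneg]
      exact div_nonneg (hk0 x (Ioc_subset_Icc_self hx)) (sq_nonneg _)
    · refine ContinuousOn.intervalIntegrable_of_Icc hpq ?_
      exact hk.div (hhc.pow 2) fun x hx => pow_ne_zero _ (hne x hx)
  have hnorm : ‖∫ x in p..q, exp (Ψ x * I)‖ ≤ |(h q)⁻¹| + |(h p)⁻¹| + ((h p)⁻¹ - (h q)⁻¹) := by
    rw [← mul_one ‖∫ x in p..q, exp (Ψ x * I)‖, ← norm_I, ← norm_mul, ← hL, hibp]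
    refine (norm_sub_le _ _).trans (add_le_add ((norm_sub_le _ _).trans (le_of_eq ?_)) hR)
    simp only [norm_mul, norm_exp_ofReal_mul_I, mul_one, norm_real, Real.norm_eq_abs]
  have hp' := left_mem_Icc.2 hpq
  have hq' := right_mem_Icc.2 hpq
  rw [div_eq_mul_inv]
  -- For either sign the boundary terms and the variation add up to twice the reciprocal of `|h|` at
  -- one endpoint.
  rcases hb with hb | hb
  · have h1 := inv_anti₀ hδ (hb p hp')
    rw [abs_of_pos (inv_pos.2 (hδ.trans_le (hb p hp'))),
      abs_of_pos (inv_pos.2 (hδ.trans_le (hb q hq')))] at hnorm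
    linarith
  · have h1 : (-h q)⁻¹ ≤ δ⁻¹ := inv_anti₀ hδ (by linarith [hb q hq'])
    rw [inv_neg] at h1
    rw [abs_of_neg (inv_lt_zero.2 (by linarith [hb q hq'])),
      abs_of_neg (inv_lt_zero.2 (by linarith [hb p hp']))] at hnorm
    linarith

/-- A continuous increasing function crosses each level at most once. -/
lemma exists_crossing_of_monotoneOn {g : ℝ → ℝ} {A B : ℝ} (v : ℝ) (hAB : A ≤ B)
    (hg : ContinuousOn g (Icc A B)) (hmono : MonotoneOn g (Icc A B)) :
    ∃ q ∈ Icc A B, (q = A ∨ ∀ x ∈ Icc A q, g x ≤ v) ∧ (q = B ∨ ∀ x ∈ Icc q B, v ≤ g x) := by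
  rcases le_or_gt v (g A) with h | h
  · exact ⟨A, left_mem_Icc.2 hAB, Or.inl rfl,
      Or.inr fun x hx => h.trans (hmono (left_mem_Icc.2 hAB) hx hx.1)⟩
  rcases le_or_gt (g B) v with h' | h'
  · exact ⟨B, right_mem_Icc.2 hAB, Or.inr fun x hx =>
      (hmono hx (right_mem_Icc.2 hAB) hx.2).trans h', Or.inl rfl⟩
  obtain ⟨q, hq, rfl⟩ := intermediate_value_Icc hAB hg ⟨h.le, h'.le⟩
  exact ⟨q, hq, Or.inr fun x hx => hmono ⟨hx.1, hx.2.trans hq.2⟩ hq hx.2,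
    Or.inr fun x hx => hmono hq ⟨hq.1.trans hx.1, hx.2⟩ hx.1⟩

lemma norm_integral_exp_ofReal_mul_I_le {Ψ : ℝ → ℝ} {p q : ℝ} (hpq : p ≤ q) :
    ‖∫ x in p..q, exp (Ψ x * I)‖ ≤ q - p := by
  have := intervalIntegral.norm_integral_le_of_norm_le_const (a := p) (b := q)
    (f := fun x => exp (Ψ x * I)) (C := 1) fun x _ => (norm_exp_ofReal_mul_I _).le
  rwa [one_mul, abs_of_nonneg (sub_nonneg.2 hpq)] at this

/-- Two bounds for an oscillatory integral whose phase `ψ x - ν x` has an increasing derivative. -/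
lemma exists_bounds_integral_exp_of_monotone {ψ u k : ℝ → ℝ} {A B ν s t : ℝ} (hAB : A ≤ B)
    (hν : 0 < ν) (hs : 0 < s) (ht : 0 < t) (ht1 : t < 1)
    (hψ : ∀ x ∈ Icc A B, HasDerivAt ψ (u x) x) (hu : ∀ x ∈ Icc A B, HasDerivAt u (k x) x)
    (hk : ContinuousOn k (Icc A B)) (hu0 : ∀ x ∈ Icc A B, 0 ≤ u x)
    (hk0 : ∀ x ∈ Icc A B, 0 ≤ k x) :
    ∃ q ∈ Icc A B, (q = A ∨ (u A ≤ (1 + s) * ν ∧ u q ≤ (1 + s) * ν)) ∧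
      ‖∫ x in A..B, exp ((ψ x - ν * x : ℝ) * I)‖ ≤ q - A + 2 / (s * ν) ∧
      (1 - t) * ν * ‖∫ x in A..B, exp ((ψ x - ν * x : ℝ) * I)‖ ≤
        ψ q - ψ A + (1 - t) * (2 / s + 2 / t) := by
  have huc : ContinuousOn u (Icc A B) := continuousOn_of_forall_hasDerivAt hu
  have hψc : ContinuousOn ψ (Icc A B) := continuousOn_of_forall_hasDerivAt hψ
  have humono : MonotoneOn u (Icc A B) := by
    refine monotoneOn_of_deriv_nonneg (convex_Icc A B) huc (fun x hx => ?_) fun x hx => ?_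
    · exact (hu x (interior_subset hx)).differentiableAt.differentiableWithinAt
    · rw [(hu x (interior_subset hx)).deriv]
      exact hk0 x (interior_subset hx)
  -- Beyond `q` the phase derivative is at least `sν`; before the point `c` below it is at most
  -- `-tν`. Only `[c, q]` is estimated trivially, and there `u ≥ (1 - t)ν` lets the growth of `ψ`
  -- bound its length.
  obtain ⟨q, hq, hq1, hq2⟩ := exists_crossing_of_monotoneOn ((1 + s) * ν) hAB huc humono
  have hAq : Icc A q ⊆ Icc A B := Icc_subset_Icc_right hq.2
  obtain ⟨c, hc, hc1, hc2⟩ := exists_crossing_of_monotoneOn ((1 - t) * ν) hq.1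
    (huc.mono hAq) (humono.mono hAq)
  have hsub : ∀ p r, A ≤ p → r ≤ B → Icc p r ⊆ Icc A B := fun p r h1 h2 => Icc_subset_Icc h1 h2
  have hint : ∀ p r, A ≤ p → p ≤ r → r ≤ B → IntervalIntegrable
      (fun x => exp ((ψ x - ν * x : ℝ) * I)) MeasureTheory.volume p r := by
    intro p r h1 h2 h3
    refine ContinuousOn.intervalIntegrable_of_Icc h2 (continuous_exp.comp_continuousOn
      ((continuous_ofReal.comp_continuousOn ?_).mul continuousOn_const))
    exact (hψc.mono (hsub p r h1 h3)).sub (by fun_prop)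
  have hvdc : ∀ p r δ, A ≤ p → p ≤ r → r ≤ B → 0 < δ →
      ((∀ x ∈ Icc p r, δ ≤ u x - ν) ∨ ∀ x ∈ Icc p r, u x - ν ≤ -δ) →
      ‖∫ x in p..r, exp ((ψ x - ν * x : ℝ) * I)‖ ≤ 2 / δ := by
    intro p r δ h1 h2 h3 hδ hb
    have hm := hsub p r h1 h3
    refine norm_integral_exp_le_of_deriv h2 hδ (h := fun x => u x - ν) (k := k) (fun x hx => ?_)
      (fun x hx => (hu x (hm hx)).sub_const ν) (hk.mono hm) (fun x hx => hk0 x (hm hx)) hb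
    simpa using (hψ x (hm hx)).fun_sub ((hasDerivAt_id x).const_mul ν)
  have hR : ‖∫ x in q..B, exp ((ψ x - ν * x : ℝ) * I)‖ ≤ 2 / (s * ν) := by
    rcases hq2 with rfl | hq2
    · rw [intervalIntegral.integral_same, norm_zero]
      positivity
    · exact hvdc q B (s * ν) hq.1 hq.2 le_rfl (by positivity)
        (Or.inl fun x hx => by linarith [hq2 x hx])
  have hLc : ‖∫ x in A..c, exp ((ψ x - ν * x : ℝ) * I)‖ ≤ 2 / (t * ν) := by
    rcases hc1 with rfl | hc1
    · rw [intervalIntegral.integral_same, norm_zero]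
      positivity
    · exact hvdc A c (t * ν) le_rfl hc.1 (hc.2.trans hq.2) (by positivity)
        (Or.inr fun x hx => by linarith [hc1 x hx])
  have hgrow : ∀ p r v, A ≤ p → p ≤ r → r ≤ B → (∀ x ∈ Icc p r, v ≤ u x) →
      v * (r - p) ≤ ψ r - ψ p := by
    intro p r v h1 h2 h3 hv
    have hm := hsub p r h1 h3
    have e := intervalIntegral.integral_eq_sub_of_hasDerivAt (f := ψ) (f' := u) (a := p) (b := r)
      (fun x hx => hψ x (hm (by rwa [uIcc_of_le h2] at hx)))
      ((huc.mono hm).intervalIntegrable_of_Icc h2)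
    have h4 := intervalIntegral.integral_mono_on (μ := MeasureTheory.volume) (a := p) (b := r)
      (f := fun _ => v) (g := u) h2
      (by simp) ((huc.mono hm).intervalIntegrable_of_Icc h2) hv
    rw [e, intervalIntegral.integral_const, smul_eq_mul] at h4
    linarith
  have hcq : (1 - t) * ν * (q - c) ≤ ψ q - ψ c := by
    rcases hc2 with rfl | hc2
    · simp
    · exact hgrow c q _ hc.1 hc.2 hq.2 hc2
  have hAc : 0 ≤ ψ c - ψ A := by
    have := hgrow A c 0 le_rfl hc.1 (hc.2.trans hq.2)
      fun x hx => hu0 x (hsub A c le_rfl (hc.2.trans hq.2) hx)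
    linarith
  have hsplit1 := intervalIntegral.integral_add_adjacent_intervals (hint A q le_rfl hq.1 hq.2)
    (hint q B hq.1 hq.2 le_rfl)
  have hsplit2 := intervalIntegral.integral_add_adjacent_intervals
    (hint A c le_rfl hc.1 (hc.2.trans hq.2)) (hint c q hc.1 hc.2 hq.2)
  have hn1 : ‖∫ x in A..B, exp ((ψ x - ν * x : ℝ) * I)‖ ≤
      ‖∫ x in A..q, exp ((ψ x - ν * x : ℝ) * I)‖ + 2 / (s * ν) := by
    rw [← hsplit1]
    exact (norm_add_le _ _).trans (add_le_add le_rfl hR)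
  have hn2 : ‖∫ x in A..q, exp ((ψ x - ν * x : ℝ) * I)‖ ≤ 2 / (t * ν) + (q - c) := by
    rw [← hsplit2]
    exact (norm_add_le _ _).trans (add_le_add hLc (norm_integral_exp_ofReal_mul_I_le hc.2))
  refine ⟨q, hq, ?_, ?_, ?_⟩
  · exact hq1.imp id fun h => ⟨h A (left_mem_Icc.2 hq.1), h q (right_mem_Icc.2 hq.1)⟩
  · exact hn1.trans (add_le_add (norm_integral_exp_ofReal_mul_I_le hq.1) le_rfl)
  · have h1 : ‖∫ x in A..B, exp ((ψ x - ν * x : ℝ) * I)‖ ≤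
        2 / (t * ν) + (q - c) + 2 / (s * ν) := hn1.trans (by linarith)
    have h2 : 0 < (1 - t) * ν := mul_pos (by linarith) hν
    calc _ ≤ (1 - t) * ν * (2 / (t * ν) + (q - c) + 2 / (s * ν)) :=
          mul_le_mul_of_nonneg_left h1 h2.le
      _ = (1 - t) * ν * (q - c) + (1 - t) * (2 / s + 2 / t) := by
          field_simp
          ring
      _ ≤ _ := by linarith

/-- Two bounds for an oscillatory integral whose phase `ψ x - ν x` has a convex derivative. -/
lemma exists_bounds_integral_exp_of_convex {ψ u k : ℝ → ℝ} {A B ν s t : ℝ} (hAB : A ≤ B)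
    (hν : 0 < ν) (hs : 0 < s) (ht : 0 < t) (ht1 : t < 1)
    (hψ : ∀ x ∈ Icc A B, HasDerivAt ψ (u x) x) (hu : ∀ x ∈ Icc A B, HasDerivAt u (k x) x)
    (hk : ContinuousOn k (Icc A B)) (hu0 : ∀ x ∈ Icc A B, 0 ≤ u x)
    (hkmono : MonotoneOn k (Icc A B)) :
    ∃ p q, A ≤ p ∧ p ≤ q ∧ q ≤ B ∧ (p = q ∨ (u p ≤ (1 + s) * ν ∧ u q ≤ (1 + s) * ν)) ∧
      ‖∫ x in A..B, exp ((ψ x - ν * x : ℝ) * I)‖ ≤ q - p + 4 / (s * ν) ∧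
      (1 - t) * ν * ‖∫ x in A..B, exp ((ψ x - ν * x : ℝ) * I)‖ ≤
        ψ q - ψ p + (1 - t) * (4 / s + 4 / t) := by
  -- The minimum of the convex function `u`: it decreases up to `M` and increases after it.
  obtain ⟨M, hM, hM1, hM2⟩ := exists_crossing_of_monotoneOn 0 hAB hk hkmono
  have ht1' : 0 < 1 - t := by linarith
  have hright : ∃ q ∈ Icc M B, (q = M ∨ (u M ≤ (1 + s) * ν ∧ u q ≤ (1 + s) * ν)) ∧
      ‖∫ x in M..B, exp ((ψ x - ν * x : ℝ) * I)‖ ≤ q - M + 2 / (s * ν) ∧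
      (1 - t) * ν * ‖∫ x in M..B, exp ((ψ x - ν * x : ℝ) * I)‖ ≤
        ψ q - ψ M + (1 - t) * (2 / s + 2 / t) := by
    rcases hM2 with rfl | hM2
    · refine ⟨M, ⟨le_rfl, le_rfl⟩, Or.inl rfl, ?_, ?_⟩
      · rw [intervalIntegral.integral_same, norm_zero, sub_self, zero_add]
        positivity
      · rw [intervalIntegral.integral_same, norm_zero, mul_zero, sub_self, zero_add]
        positivity
    · have hm : Icc M B ⊆ Icc A B := Icc_subset_Icc_left hM.1
      exact exists_bounds_integral_exp_of_monotone hM.2 hν hs ht ht1 (fun x hx => hψ x (hm hx))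
        (fun x hx => hu x (hm hx)) (hk.mono hm) (fun x hx => hu0 x (hm hx)) hM2
  have hleft : ∃ p ∈ Icc A M, (p = M ∨ (u M ≤ (1 + s) * ν ∧ u p ≤ (1 + s) * ν)) ∧
      ‖∫ x in A..M, exp ((ψ x - ν * x : ℝ) * I)‖ ≤ M - p + 2 / (s * ν) ∧
      (1 - t) * ν * ‖∫ x in A..M, exp ((ψ x - ν * x : ℝ) * I)‖ ≤
        ψ M - ψ p + (1 - t) * (2 / s + 2 / t) := by
    rcases hM1 with rfl | hM1
    · refine ⟨M, ⟨le_rfl, le_rfl⟩, Or.inl rfl, ?_, ?_⟩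
      · rw [intervalIntegral.integral_same, norm_zero, sub_self, zero_add]
        positivity
      · rw [intervalIntegral.integral_same, norm_zero, mul_zero, sub_self, zero_add]
        positivity
    · have hm : ∀ x ∈ Icc (-M) (-A), -x ∈ Icc A M := fun x hx =>
        ⟨by linarith [hx.2], by linarith [hx.1]⟩
      have hm' : ∀ x ∈ Icc (-M) (-A), -x ∈ Icc A B := fun x hx =>
        ⟨(hm x hx).1, (hm x hx).2.trans hM.2⟩
      -- The reflected phase `-ψ(-x)` has increasing derivative `u(-x)`, and its integral is the
      -- conjugate of the original one.
      obtain ⟨q, hq, h1, h2, h3⟩ := exists_bounds_integral_exp_of_monotone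
        (ψ := fun x => -ψ (-x)) (u := fun x => u (-x)) (k := fun x => -k (-x)) (A := -M) (B := -A)
        (neg_le_neg hM.1) hν hs ht ht1
        (fun x hx => by
          have h1 : HasDerivAt (fun x => ψ (-x)) _ x :=
            (hψ (-x) (hm' x hx)).scomp x (hasDerivAt_neg x)
          simpa using h1.fun_neg)
        (fun x hx => by
          have h1 : HasDerivAt (fun x => u (-x)) _ x :=
            (hu (-x) (hm' x hx)).scomp x (hasDerivAt_neg x)
          simpa using h1)
        ((hk.comp (continuous_neg.continuousOn) hm').neg) (fun x hx => hu0 _ (hm' x hx))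
        (fun x hx => by linarith [hM1 _ (hm x hx)])
      have e : ‖∫ x in (-M)..(-A), exp ((-ψ (-x) - ν * x : ℝ) * I)‖ =
          ‖∫ x in A..M, exp ((ψ x - ν * x : ℝ) * I)‖ := by
        have e1 : ∀ x : ℝ, exp ((-ψ (-x) - ν * x : ℝ) * I) =
            (fun y : ℝ => conj (exp ((ψ y - ν * y : ℝ) * I))) (-x) := by
          intro x
          simp only [← exp_conj, map_mul, conj_ofReal, conj_I]
          congr 1
          push_cast
          ring
        rw [intervalIntegral.integral_congr (fun x _ => e1 x),
          intervalIntegral.integral_comp_neg (fun y : ℝ => conj (exp ((ψ y - ν * y : ℝ) * I))),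
          neg_neg, neg_neg, intervalIntegral.intervalIntegral_conj, norm_conj]
      simp only [neg_neg] at h1 h3
      rw [e] at h2 h3
      refine ⟨-q, ⟨by linarith [hq.2], by linarith [hq.1]⟩, ?_, by linarith, by linarith⟩
      exact h1.imp (fun h => by rw [h, neg_neg]) id
  obtain ⟨q, hq, hq1, hq2, hq3⟩ := hright
  obtain ⟨p, hp, hp1, hp2, hp3⟩ := hleft
  have hψc : ContinuousOn ψ (Icc A B) := continuousOn_of_forall_hasDerivAt hψ
  have hint : ∀ p r, A ≤ p → p ≤ r → r ≤ B → IntervalIntegrable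
      (fun x => exp ((ψ x - ν * x : ℝ) * I)) MeasureTheory.volume p r := by
    intro p r h1 h2 h3
    refine ContinuousOn.intervalIntegrable_of_Icc h2 (continuous_exp.comp_continuousOn
      ((continuous_ofReal.comp_continuousOn ?_).mul continuousOn_const))
    exact (hψc.mono (Icc_subset_Icc h1 h3)).sub (by fun_prop)
  have hn : ‖∫ x in A..B, exp ((ψ x - ν * x : ℝ) * I)‖ ≤
      ‖∫ x in A..M, exp ((ψ x - ν * x : ℝ) * I)‖ + ‖∫ x in M..B, exp ((ψ x - ν * x : ℝ) * I)‖ := by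
    rw [← intervalIntegral.integral_add_adjacent_intervals (hint A M le_rfl hM.1 hM.2)
      (hint M B hM.1 hM.2 le_rfl)]
    exact norm_add_le _ _
  refine ⟨p, q, hp.1, hp.2.trans hq.1, hq.2, ?_, ?_, ?_⟩
  · rcases hp1 with rfl | hp1
    · rcases hq1 with rfl | hq1
      · exact Or.inl rfl
      · exact Or.inr hq1
    · rcases hq1 with rfl | hq1
      · exact Or.inr ⟨hp1.2, hp1.1⟩
      · exact Or.inr ⟨hp1.2, hq1.2⟩
  · have : 4 / (s * ν) = 2 / (s * ν) + 2 / (s * ν) := by ring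
    linarith
  · have h1 := mul_le_mul_of_nonneg_left hn (mul_pos ht1' hν).le
    have h2 : (1 - t) * (4 / s + 4 / t) =
      (1 - t) * (2 / s + 2 / t) + (1 - t) * (2 / s + 2 / t) := by ring
    linarith

/-- Sum of increments over disjoint intervals within a period, when increments between endpoints
are controlled. -/
lemma sum_increments_le {ψ : ℝ → ℝ} {S : Set ℝ} {K L : ℝ} (hK : 0 ≤ K) (hL : 0 ≤ L)
    (hkey : ∀ x ∈ S, ∀ y ∈ S, x ≤ y → ψ x - ψ y ≤ K * (y - x))
    (hper : ∀ x ∈ S, x + L ∈ S ∧ ψ (x + L) = ψ x) {N : ℕ} {p q : ℕ → ℝ} {A : ℝ}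
    (hA : ∀ i < N, A ≤ p i) (hB : ∀ i < N, q i ≤ A + L) (hpq : ∀ i < N, p i ≤ q i)
    (hqp : ∀ i j, i < j → j < N → q i ≤ p j)
    (hS : ∀ i < N, p i = q i ∨ (p i ∈ S ∧ q i ∈ S)) :
    ∑ i ∈ Finset.range N, (ψ (q i) - ψ (p i)) ≤
      K * (L - ∑ i ∈ Finset.range N, (q i - p i)) := by
  -- `P` and `Q` are the outer endpoints of the nondegenerate intervals met so far. Degenerate ones
  -- may lie outside `S` and are skipped, as they contribute nothing.
  have hind : ∀ m ≤ N, (∑ i ∈ Finset.range m, (ψ (q i) - ψ (p i)) = 0 ∧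
      ∑ i ∈ Finset.range m, (q i - p i) = 0) ∨ ∃ P ∈ S, ∃ Q ∈ S, A ≤ P ∧ Q ≤ A + L ∧ P ≤ Q ∧
      (∀ j < N, m ≤ j → Q ≤ p j) ∧ ∑ i ∈ Finset.range m, (ψ (q i) - ψ (p i)) ≤
        ψ Q - ψ P + K * (Q - P - ∑ i ∈ Finset.range m, (q i - p i)) := by
    intro m
    induction m with
    | zero => exact fun _ => Or.inl (by simp)
    | succ m ih =>
      intro hm
      have hmN : m < N := hm
      rw [Finset.sum_range_succ, Finset.sum_range_succ]
      rcases ih hmN.le with ⟨h1, h2⟩ | ⟨P, hP, Q, hQ, hAP, hQB, hPQ, hnext, hle⟩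
      · rw [h1, h2]
        rcases hS m hmN with h | ⟨hp, hq⟩
        · exact Or.inl (by simp [h])
        · refine Or.inr ⟨p m, hp, q m, hq, hA m hmN, hB m hmN, hpq m hmN, fun j hj hmj =>
            hqp m j hmj hj, ?_⟩
          simp
      · right
        rcases hS m hmN with h | ⟨hp, hq⟩
        · refine ⟨P, hP, Q, hQ, hAP, hQB, hPQ, fun j hj hmj => hnext j hj (by omega), ?_⟩
          simpa [h] using hle
        · have h3 := hnext m hmN le_rfl
          refine ⟨P, hP, q m, hq, hAP, hB m hmN, (hPQ.trans h3).trans (hpq m hmN),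
            fun j hj hmj => hqp m j hmj hj, ?_⟩
          have := hkey Q hQ (p m) hp h3
          linarith
  rcases hind N le_rfl with ⟨h1, h2⟩ | ⟨P, hP, Q, hQ, hAP, hQB, hPQ, -, hle⟩
  · rw [h1, h2, sub_zero]
    positivity
  · have h1 := hkey Q hQ (P + L) (hper P hP).1 (by linarith)
    rw [(hper P hP).2] at h1
    linarith

/-! ### The boundary phase and the main estimate -/

section Phase

variable {N : ℕ}

/-- The boundary argument of the atomic singular inner function with atoms at angles `x j`. -/
noncomputable def atomicPhase (w x : Fin N → ℝ) (θ : ℝ) : ℝ :=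
  -∑ j, w j * (Real.cos ((θ - x j) / 2) / Real.sin ((θ - x j) / 2))

/-- The derivative of `atomicPhase`. -/
noncomputable def atomicPhaseDeriv (w x : Fin N → ℝ) (θ : ℝ) : ℝ :=
  ∑ j, w j / 2 / Real.sin ((θ - x j) / 2) ^ 2

/-- The second derivative of `atomicPhase`. -/
noncomputable def atomicPhaseDeriv₂ (w x : Fin N → ℝ) (θ : ℝ) : ℝ :=
  -∑ j, w j / 2 * (Real.cos ((θ - x j) / 2) / Real.sin ((θ - x j) / 2) ^ 3)

/-- Angles at which no atom sits. -/
def regularAngles (x : Fin N → ℝ) : Set ℝ := {θ | ∀ j, Real.sin ((θ - x j) / 2) ≠ 0}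

variable {w x : Fin N → ℝ} {θ : ℝ}

lemma hasDerivAt_half_sub (c : ℝ) : HasDerivAt (fun θ : ℝ => (θ - c) / 2) (1 / 2) θ :=
  ((hasDerivAt_id θ).sub_const c).div_const 2

lemma hasDerivAt_sin_half_sub (c : ℝ) :
    HasDerivAt (fun θ : ℝ => Real.sin ((θ - c) / 2)) (Real.cos ((θ - c) / 2) * (1 / 2)) θ :=
  (hasDerivAt_half_sub c).sin

lemma hasDerivAt_cos_half_sub (c : ℝ) :
    HasDerivAt (fun θ : ℝ => Real.cos ((θ - c) / 2)) (-Real.sin ((θ - c) / 2) * (1 / 2)) θ :=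
  (hasDerivAt_half_sub c).cos

lemma hasDerivAt_atomicPhase (h : θ ∈ regularAngles x) :
    HasDerivAt (atomicPhase w x) (atomicPhaseDeriv w x θ) θ := by
  have h1 : ∀ j ∈ Finset.univ, HasDerivAt
      (fun θ : ℝ => w j * (Real.cos ((θ - x j) / 2) / Real.sin ((θ - x j) / 2)))
      (-(w j / 2 / Real.sin ((θ - x j) / 2) ^ 2)) θ := fun j _ => by
    have hs := h j
    refine (((hasDerivAt_cos_half_sub (x j)).fun_div (hasDerivAt_sin_half_sub (x j)) hs).const_mul
      (w j)).congr_deriv ?_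
    have := Real.sin_sq_add_cos_sq ((θ - x j) / 2)
    field_simp
    linear_combination (-w j) * this
  have h2 := (HasDerivAt.fun_sum h1).fun_neg
  rwa [Finset.sum_neg_distrib, neg_neg] at h2

lemma hasDerivAt_atomicPhaseDeriv (h : θ ∈ regularAngles x) :
    HasDerivAt (atomicPhaseDeriv w x) (atomicPhaseDeriv₂ w x θ) θ := by
  have h1 : ∀ j ∈ Finset.univ, HasDerivAt
      (fun θ : ℝ => w j / 2 / Real.sin ((θ - x j) / 2) ^ 2)
      (-(w j / 2 * (Real.cos ((θ - x j) / 2) / Real.sin ((θ - x j) / 2) ^ 3))) θ := fun j _ => by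
    have hs := h j
    refine ((hasDerivAt_const θ (w j / 2)).fun_div ((hasDerivAt_sin_half_sub (x j)).fun_pow 2)
      (pow_ne_zero 2 hs)).congr_deriv ?_
    field_simp
    push_cast
    ring
  have h2 := HasDerivAt.fun_sum h1
  rwa [Finset.sum_neg_distrib] at h2

lemma hasDerivAt_neg_cos_div_sin_pow_three (c : ℝ) (h : Real.sin ((θ - c) / 2) ≠ 0) :
    HasDerivAt (fun θ : ℝ => -(Real.cos ((θ - c) / 2) / Real.sin ((θ - c) / 2) ^ 3))
      ((1 + 2 * Real.cos ((θ - c) / 2) ^ 2) / (2 * Real.sin ((θ - c) / 2) ^ 4)) θ := by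
  refine ((hasDerivAt_cos_half_sub c).fun_div ((hasDerivAt_sin_half_sub c).fun_pow 3)
    (pow_ne_zero 3 h)).fun_neg.congr_deriv ?_
  have := Real.sin_sq_add_cos_sq ((θ - c) / 2)
  field_simp
  push_cast
  linear_combination Real.sin ((θ - c) / 2) ^ 2 * this

/-- Each summand has a positive derivative away from its pole; so `ψ'` is convex on every arc free
of atoms. -/
lemma monotoneOn_atomicPhaseDeriv₂ (hw : ∀ j, 0 ≤ w j) {A B : ℝ}
    (h : Icc A B ⊆ regularAngles x) : MonotoneOn (atomicPhaseDeriv₂ w x) (Icc A B) := by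
  have hterm : ∀ j, MonotoneOn
      (fun θ : ℝ => -(Real.cos ((θ - x j) / 2) / Real.sin ((θ - x j) / 2) ^ 3)) (Icc A B) := by
    intro j
    have hd := fun θ hθ => hasDerivAt_neg_cos_div_sin_pow_three (θ := θ) (x j) (h hθ j)
    refine monotoneOn_of_deriv_nonneg (convex_Icc A B) (continuousOn_of_forall_hasDerivAt hd)
      (fun θ hθ => (hd θ (interior_subset hθ)).differentiableAt.differentiableWithinAt)
      fun θ hθ => ?_
    rw [(hd θ (interior_subset hθ)).deriv]
    positivity
  intro y hy z hz hyz
  have : ∀ θ, atomicPhaseDeriv₂ w x θ =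
      ∑ j, w j / 2 * -(Real.cos ((θ - x j) / 2) / Real.sin ((θ - x j) / 2) ^ 3) := fun θ => by
    simp [atomicPhaseDeriv₂]
  rw [this, this]
  exact Finset.sum_le_sum fun j _ =>
    mul_le_mul_of_nonneg_left (hterm j hy hz hyz) (by linarith [hw j])

lemma continuousOn_atomicPhaseDeriv₂ : ContinuousOn (atomicPhaseDeriv₂ w x) (regularAngles x) := by
  refine (continuousOn_finsetSum _ fun j _ => continuousOn_const.mul ?_).neg
  exact ContinuousOn.div (by fun_prop) (by fun_prop) fun θ hθ => pow_ne_zero 3 (hθ j)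

lemma atomicPhaseDeriv_nonneg (hw : ∀ j, 0 ≤ w j) (θ : ℝ) : 0 ≤ atomicPhaseDeriv w x θ :=
  Finset.sum_nonneg fun j _ => div_nonneg (by linarith [hw j]) (sq_nonneg _)

/-- The difference equals `sin (b - a) / (sin a sin b)`; use `|sin u| ≤ |u|` and the
arithmetic-geometric mean inequality. Poles between `a` and `b` do no harm, which is what allows
jumping over atoms. -/
lemma abs_cot_sub_cot_le {a b : ℝ} (ha : Real.sin a ≠ 0) (hb : Real.sin b ≠ 0) :
    |Real.cos a / Real.sin a - Real.cos b / Real.sin b| ≤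
      |b - a| * ((1 / Real.sin a ^ 2 + 1 / Real.sin b ^ 2) / 2) := by
  have h1 : Real.cos a / Real.sin a - Real.cos b / Real.sin b =
      Real.sin (b - a) * ((Real.sin a)⁻¹ * (Real.sin b)⁻¹) := by
    rw [Real.sin_sub]
    field_simp
  rw [h1, abs_mul]
  refine mul_le_mul (Real.abs_sin_le_abs) ?_ (abs_nonneg _) (abs_nonneg _)
  rw [one_div, one_div, ← inv_pow, ← inv_pow, abs_le]
  constructor
  · nlinarith [sq_nonneg ((Real.sin a)⁻¹ + (Real.sin b)⁻¹)]
  · nlinarith [sq_nonneg ((Real.sin a)⁻¹ - (Real.sin b)⁻¹)]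

/-- Increments of the phase are bounded by the trapezoidal rule, even across atoms. -/
lemma atomicPhase_sub_le (hw : ∀ j, 0 ≤ w j) {y z : ℝ} (hy : y ∈ regularAngles x)
    (hz : z ∈ regularAngles x) : atomicPhase w x y - atomicPhase w x z ≤
      |z - y| * ((atomicPhaseDeriv w x y + atomicPhaseDeriv w x z) / 2) := by
  have h1 : atomicPhase w x y - atomicPhase w x z =
      ∑ j, w j * (Real.cos ((z - x j) / 2) / Real.sin ((z - x j) / 2) -
        Real.cos ((y - x j) / 2) / Real.sin ((y - x j) / 2)) := by
    simp only [atomicPhase, mul_sub, Finset.sum_sub_distrib]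
    ring
  have h2 : |z - y| * ((atomicPhaseDeriv w x y + atomicPhaseDeriv w x z) / 2) =
      ∑ j, w j * (|z - y| / 2 * ((1 / Real.sin ((z - x j) / 2) ^ 2 +
        1 / Real.sin ((y - x j) / 2) ^ 2) / 2)) := by
    simp only [atomicPhaseDeriv, ← Finset.sum_add_distrib, Finset.sum_div, Finset.mul_sum]
    refine Finset.sum_congr rfl fun j _ => ?_
    ring
  rw [h1, h2]
  refine Finset.sum_le_sum fun j _ => mul_le_mul_of_nonneg_left ?_ (hw j)
  have h3 := (le_abs_self _).trans (abs_cot_sub_cot_le (hz j) (hy j))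
  have h4 : |(y - x j) / 2 - (z - x j) / 2| = |z - y| / 2 := by
    rw [show (y - x j) / 2 - (z - x j) / 2 = -((z - y) / 2) by ring, abs_neg, abs_div, abs_two]
  rwa [h4] at h3

lemma half_sub_add_two_pi (θ c : ℝ) : (θ + 2 * π - c) / 2 = (θ - c) / 2 + π := by ring

lemma atomicPhase_add_two_pi (θ : ℝ) : atomicPhase w x (θ + 2 * π) = atomicPhase w x θ := by
  simp only [atomicPhase, half_sub_add_two_pi, Real.cos_add_pi, Real.sin_add_pi, neg_div_neg_eq]

lemma add_two_pi_mem_regularAngles (h : θ ∈ regularAngles x) : θ + 2 * π ∈ regularAngles x := by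
  intro j
  rw [half_sub_add_two_pi, Real.sin_add_pi]
  exact neg_ne_zero.2 (h j)

lemma measurable_atomicPhase : Measurable (atomicPhase w x) := by
  unfold atomicPhase
  fun_prop

/-- Increasing angles `x 0 < x 1 < ⋯`, continued by `x 0 + 2π`. -/
noncomputable def angleSeq (x : Fin N → ℝ) (i : ℕ) : ℝ :=
  if h : i < N then x ⟨i, h⟩ else if h : 0 < N then x ⟨0, h⟩ + 2 * π else 0

lemma angleSeq_of_lt {i : ℕ} (h : i < N) : angleSeq x i = x ⟨i, h⟩ := dif_pos h

lemma angleSeq_card (h : 0 < N) : angleSeq x N = x ⟨0, h⟩ + 2 * π := by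
  rw [angleSeq, dif_neg (lt_irrefl N), dif_pos h]

lemma angleSeq_lt_angleSeq (hx : StrictMono x) (h2 : ∀ i j, x i < x j + 2 * π) {i j : ℕ}
    (hij : i < j) (hj : j ≤ N) : angleSeq x i < angleSeq x j := by
  rcases hj.lt_or_eq with h | rfl
  · rw [angleSeq_of_lt h, angleSeq_of_lt (hij.trans h)]
    exact hx hij
  · rw [angleSeq_of_lt hij, angleSeq_card (i.zero_le.trans_lt hij)]
    exact h2 _ _

lemma Ioo_angleSeq_subset_regularAngles (hx : StrictMono x) (h2 : ∀ i j, x i < x j + 2 * π)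
    {i : ℕ} (hi : i < N) : Ioo (angleSeq x i) (angleSeq x (i + 1)) ⊆ regularAngles x := by
  rintro θ ⟨h3, h4⟩ j
  have hN : 0 < N := by omega
  have h0N : angleSeq x N = angleSeq x 0 + 2 * π := by
    rw [angleSeq_card hN, angleSeq_of_lt hN]
  have hmono : ∀ k l, k ≤ l → l ≤ N → angleSeq x k ≤ angleSeq x l := fun k l hkl hl =>
    hkl.lt_or_eq.elim (fun h => (angleSeq_lt_angleSeq hx h2 h hl).le) fun h => h ▸ le_rfl
  have hj : x j = angleSeq x j := by rw [angleSeq_of_lt j.2]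
  have e0 := hmono 0 j (Nat.zero_le _) j.2.le
  have eN := angleSeq_lt_angleSeq hx h2 j.2 le_rfl
  have e1 := hmono (i + 1) N hi le_rfl
  have e2 := hmono 0 i (Nat.zero_le _) hi.le
  rcases le_or_gt (j : ℕ) i with h | h
  · have e3 := hmono j i h hi.le
    exact (Real.sin_pos_of_pos_of_lt_pi (by linarith) (by linarith)).ne'
  · have e3 := hmono (i + 1) j h j.2.le
    exact (Real.sin_neg_of_neg_of_neg_pi_lt (by linarith) (by linarith)).ne

/-- The main estimate: few atoms force a small Fourier coefficient. -/
lemma norm_integral_exp_atomicPhase_le (hN : 0 < N) (hw : ∀ j, 0 ≤ w j) (hx : StrictMono x)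
    (h2 : ∀ i j, x i < x j + 2 * π) {ν s t : ℝ} (hν : 0 < ν) (hs : 0 < s) (ht : 0 < t)
    (ht1 : t < 1) :
    (2 + s - t) * ν * ‖∫ θ in (x ⟨0, hN⟩)..(x ⟨0, hN⟩ + 2 * π),
        exp ((atomicPhase w x θ - ν * θ : ℝ) * I)‖ ≤
      2 * π * (1 + s) * ν + N * (4 * (2 + s - t) / s + 4 * (1 - t) / t) := by
  set y := angleSeq x with hy
  have hy0 : y 0 = x ⟨0, hN⟩ := angleSeq_of_lt hN
  have hyN : y N = x ⟨0, hN⟩ + 2 * π := angleSeq_card hN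
  have hmono : ∀ k l, k ≤ l → l ≤ N → y k ≤ y l := fun k l hkl hl =>
    hkl.lt_or_eq.elim (fun h => (angleSeq_lt_angleSeq hx h2 h hl).le) fun h => h ▸ le_rfl
  set F : ℝ → ℂ := fun θ => exp ((atomicPhase w x θ - ν * θ : ℝ) * I) with hF
  have hFn : ∀ θ, ‖F θ‖ = 1 := fun θ => norm_exp_ofReal_mul_I _
  have hFm : Measurable F := by
    have := measurable_atomicPhase (w := w) (x := x)
    fun_prop
  have hFi : ∀ a b, IntervalIntegrable F MeasureTheory.volume a b := fun a b =>
    (intervalIntegrable_const (c := (1 : ℝ))).mono_fun hFm.aestronglyMeasurable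
      (Eventually.of_forall fun θ => by simp [hFn])
  have hFle : ∀ a b, a ≤ b → ‖∫ θ in a..b, F θ‖ ≤ b - a := fun a b hab =>
    norm_integral_exp_ofReal_mul_I_le (Ψ := fun θ => atomicPhase w x θ - ν * θ) hab
  -- The phase may blow up at the atoms, so the arcs are shortened by `ε` at both ends; the loss is
  -- at most `2ε` per arc, and `ε → 0` at the end.
  obtain ⟨ε₀, hε₀, hgap⟩ : ∃ ε₀ > 0, ∀ i < N, y i + 2 * ε₀ ≤ y (i + 1) := by
    have : ∀ᶠ ε : ℝ in 𝓝[>] 0, ∀ i ∈ Finset.range N, y i + 2 * ε ≤ y (i + 1) := by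
      rw [Finset.eventually_all]
      intro i hi
      rw [Finset.mem_range] at hi
      have h1 : Tendsto (fun ε : ℝ => y i + 2 * ε) (𝓝[>] 0) (𝓝 (y i)) := by
        have : Continuous fun ε : ℝ => y i + 2 * ε := by fun_prop
        simpa using (this.tendsto 0).mono_left nhdsWithin_le_nhds
      exact h1.eventually_le_const (angleSeq_lt_angleSeq hx h2 (Nat.lt_succ_self i) hi)
    obtain ⟨ε, h1, h2⟩ := (this.and self_mem_nhdsWithin).exists
    exact ⟨ε, h2, fun i hi => h1 i (Finset.mem_range.2 hi)⟩
  have hmain : ∀ ε, 0 < ε → ε ≤ ε₀ → (2 + s - t) * ν * ‖∫ θ in (y 0)..(y N), F θ‖ ≤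
      2 * π * (1 + s) * ν + N * (4 * (2 + s - t) / s + 4 * (1 - t) / t) +
        (2 + s - t) * ν * (N * (2 * ε)) := by
    intro ε hε hεε
    have harc : ∀ i, i < N → ∃ p q, y i + ε ≤ p ∧ p ≤ q ∧ q ≤ y (i + 1) - ε ∧
        (p = q ∨ (atomicPhaseDeriv w x p ≤ (1 + s) * ν ∧ atomicPhaseDeriv w x q ≤ (1 + s) * ν)) ∧
        ‖∫ θ in (y i + ε)..(y (i + 1) - ε), F θ‖ ≤ q - p + 4 / (s * ν) ∧
        (1 - t) * ν * ‖∫ θ in (y i + ε)..(y (i + 1) - ε), F θ‖ ≤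
          atomicPhase w x q - atomicPhase w x p + (1 - t) * (4 / s + 4 / t) := by
      intro i hi
      have hsub : Icc (y i + ε) (y (i + 1) - ε) ⊆ regularAngles x := fun θ hθ =>
        Ioo_angleSeq_subset_regularAngles hx h2 hi ⟨by linarith [hθ.1], by linarith [hθ.2]⟩
      exact exists_bounds_integral_exp_of_convex (k := atomicPhaseDeriv₂ w x)
        (by linarith [hgap i hi]) hν hs ht ht1
        (fun θ hθ => hasDerivAt_atomicPhase (hsub hθ))
        (fun θ hθ => hasDerivAt_atomicPhaseDeriv (hsub hθ))
        (continuousOn_atomicPhaseDeriv₂.mono hsub) (fun θ _ => atomicPhaseDeriv_nonneg hw θ)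
        (monotoneOn_atomicPhaseDeriv₂ hw hsub)
    choose! p q hp hpq hq hPQ hb1 hb2 using harc
    have hreg : ∀ i < N, ∀ θ, y i + ε ≤ θ → θ ≤ y (i + 1) - ε → θ ∈ regularAngles x :=
      fun i hi θ h3 h4 => Ioo_angleSeq_subset_regularAngles hx h2 hi
        ⟨by linarith, by linarith⟩
    have htel := sum_increments_le (ψ := atomicPhase w x)
      (S := {θ | θ ∈ regularAngles x ∧ atomicPhaseDeriv w x θ ≤ (1 + s) * ν})
      (K := (1 + s) * ν) (L := 2 * π) (N := N) (p := p) (q := q) (A := y 0) (by positivity)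
      (by positivity) (fun a ha b hb hab => by
        refine (atomicPhase_sub_le hw ha.1 hb.1).trans ?_
        rw [abs_of_nonneg (sub_nonneg.2 hab), mul_comm]
        exact mul_le_mul_of_nonneg_right (by linarith [ha.2, hb.2]) (sub_nonneg.2 hab))
      (fun a ha => ⟨⟨add_two_pi_mem_regularAngles ha.1, by
        have : atomicPhaseDeriv w x (a + 2 * π) = atomicPhaseDeriv w x a := by
          simp only [atomicPhaseDeriv, half_sub_add_two_pi, Real.sin_add_pi, neg_sq]
        rw [this]
        exact ha.2⟩, atomicPhase_add_two_pi a⟩)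
      (fun i hi => by linarith [hp i hi, hmono 0 i (Nat.zero_le _) hi.le])
      (fun i hi => by
        rw [hy0, ← hyN]
        linarith [hq i hi, hmono (i + 1) N hi le_rfl])
      hpq (fun i j hij hj => by
        linarith [hq i (hij.trans hj), hp j hj, hmono (i + 1) j hij hj.le])
      (fun i hi => (hPQ i hi).imp id fun h =>
        ⟨⟨hreg i hi _ (hp i hi) ((hpq i hi).trans (hq i hi)), h.1⟩,
          ⟨hreg i hi _ ((hp i hi).trans (hpq i hi)) (hq i hi), h.2⟩⟩)
    set T := ∑ i ∈ Finset.range N, ‖∫ θ in (y i + ε)..(y (i + 1) - ε), F θ‖ with hT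
    have hT1 : T ≤ ∑ i ∈ Finset.range N, (q i - p i) + N * (4 / (s * ν)) := by
      calc T ≤ ∑ i ∈ Finset.range N, (q i - p i + 4 / (s * ν)) :=
            Finset.sum_le_sum fun i hi => hb1 i (Finset.mem_range.1 hi)
        _ = _ := by rw [Finset.sum_add_distrib]; simp
    have hT2 : (1 - t) * ν * T ≤ ∑ i ∈ Finset.range N, (atomicPhase w x (q i) -
        atomicPhase w x (p i)) + N * ((1 - t) * (4 / s + 4 / t)) := by
      calc (1 - t) * ν * T ≤ ∑ i ∈ Finset.range N, (atomicPhase w x (q i) -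
            atomicPhase w x (p i) + (1 - t) * (4 / s + 4 / t)) := by
            rw [hT, Finset.mul_sum]
            exact Finset.sum_le_sum fun i hi => hb2 i (Finset.mem_range.1 hi)
        _ = _ := by rw [Finset.sum_add_distrib]; simp
    have hsum : ‖∫ θ in (y 0)..(y N), F θ‖ ≤ T + N * (2 * ε) := by
      rw [← intervalIntegral.sum_integral_adjacent_intervals fun i _ => hFi (y i) (y (i + 1))]
      calc _ ≤ ∑ i ∈ Finset.range N, ‖∫ θ in (y i)..(y (i + 1)), F θ‖ := norm_sum_le _ _
        _ ≤ ∑ i ∈ Finset.range N, (‖∫ θ in (y i + ε)..(y (i + 1) - ε), F θ‖ + 2 * ε) := by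
            refine Finset.sum_le_sum fun i _ => ?_
            rw [← intervalIntegral.integral_add_adjacent_intervals (hFi (y i) (y i + ε))
              (hFi (y i + ε) (y (i + 1))),
              ← intervalIntegral.integral_add_adjacent_intervals (hFi (y i + ε) (y (i + 1) - ε))
              (hFi (y (i + 1) - ε) (y (i + 1)))]
            have e1 := hFle (y i) (y i + ε) (by linarith)
            have e2 := hFle (y (i + 1) - ε) (y (i + 1)) (by linarith)
            have e3 := norm_add₃_le (a := ∫ θ in (y i)..(y i + ε), F θ)
              (b := ∫ θ in (y i + ε)..(y (i + 1) - ε), F θ)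
              (c := ∫ θ in (y (i + 1) - ε)..(y (i + 1)), F θ)
            rw [add_assoc] at e3
            linarith
        _ = _ := by rw [Finset.sum_add_distrib]; simp [hT]
    -- The length bound with weight `(1 + s)ν` is added to the increment bound with weight `(1 -
    -- t)ν`; by `htel` the unknown lengths `q i - p i` then cancel.
    have e1 : (1 + s) * ν * T ≤ (1 + s) * ν *
        (∑ i ∈ Finset.range N, (q i - p i) + N * (4 / (s * ν))) :=
      mul_le_mul_of_nonneg_left hT1 (by positivity)
    have e2 : (2 + s - t) * ν * ‖∫ θ in (y 0)..(y N), F θ‖ ≤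
        (2 + s - t) * ν * (T + N * (2 * ε)) := by
      refine mul_le_mul_of_nonneg_left hsum ?_
      have : 0 ≤ 2 + s - t := by linarith
      positivity
    have e3 : (1 + s) * ν * (N * (4 / (s * ν))) + N * ((1 - t) * (4 / s + 4 / t)) =
        N * (4 * (2 + s - t) / s + 4 * (1 - t) / t) := by
      field_simp
      ring
    linarith
  rw [hy0, hyN] at hmain
  have hlim : Tendsto (fun ε : ℝ => 2 * π * (1 + s) * ν +
      N * (4 * (2 + s - t) / s + 4 * (1 - t) / t) + (2 + s - t) * ν * (N * (2 * ε))) (𝓝[>] 0)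
      (𝓝 (2 * π * (1 + s) * ν + N * (4 * (2 + s - t) / s + 4 * (1 - t) / t))) := by
    have : Continuous fun ε : ℝ => 2 * π * (1 + s) * ν +
      N * (4 * (2 + s - t) / s + 4 * (1 - t) / t) + (2 + s - t) * ν * (N * (2 * ε)) := by fun_prop
    simpa using (this.tendsto 0).mono_left nhdsWithin_le_nhds
  refine ge_of_tendsto hlim ?_
  filter_upwards [Ioc_mem_nhdsGT hε₀] with ε hε using hmain ε hε.1 hε.2

end Phase

/-! ### Boundary values and Fourier coefficients -/

/-- The singularity of the kernel with parameter `α` is at `α⁻¹`, whence the angle `-arg α`. Sorting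
these angles gives an increasing sequence inside one period. -/
lemma IsAtomicSingularInner.exists_strictMono_angles {f : ℂ → ℂ} {N : ℕ} {ζ : ℂ} {w : Fin N → ℝ}
    {α : Fin N → ℂ} (h : IsAtomicSingularInner f N ζ w α) :
    ∃ v x : Fin N → ℝ, (∀ j, 0 < v j) ∧ StrictMono x ∧ (∀ i j, x i < x j + 2 * π) ∧
      ∀ z ∈ ball (0 : ℂ) 1, f z = ζ * exp (-∑ j, (v j : ℂ) * halfPlaneMap (exp (-(x j * I))) z) := by
  obtain ⟨-, hw, hα, hinj, hf⟩ := h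
  have hexp : ∀ j, exp (-((-arg (α j) : ℝ) * I)) = α j := fun j => by
    have := norm_mul_exp_arg_mul_I (α j)
    rw [hα j] at this
    simpa using this
  set σ := Tuple.sort fun j => -arg (α j) with hσ
  have hinj' : Function.Injective fun j => -arg (α (σ j)) := by
    intro i j hij
    refine σ.injective (hinj ?_)
    rw [← hexp (σ i), ← hexp (σ j)]
    simp only at hij
    rw [hij]
  refine ⟨fun j => w (σ j), fun j => -arg (α (σ j)), fun j => hw _, ?_, fun i j => ?_,
    fun z hz => ?_⟩
  · exact (Tuple.monotone_sort fun j => -arg (α j)).strictMono_of_injective hinj'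
  · have h1 := neg_pi_lt_arg (α (σ i))
    have h2 := arg_le_pi (α (σ j))
    linarith
  · rw [hf z hz]
    congr 3
    rw [← Equiv.sum_comp σ fun j => (w j : ℂ) * ((1 + α j * z) / (1 - α j * z))]
    refine Finset.sum_congr rfl fun j _ => ?_
    rw [hexp, halfPlaneMap]

lemma one_sub_exp_ne_zero {c θ : ℝ} (h : Real.sin ((θ - c) / 2) ≠ 0) :
    1 - exp (-(c * I)) * exp (θ * I) ≠ 0 := by
  rw [← Complex.exp_add]
  intro h0
  rw [sub_eq_zero, eq_comm, exp_eq_one_iff] at h0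
  obtain ⟨n, hn⟩ := h0
  apply h
  have h1 : ((θ - c : ℝ) : ℂ) * I = ((n * (2 * π) : ℝ) : ℂ) * I := by
    push_cast
    linear_combination hn
  have h2 : θ - c = n * (2 * π) := ofReal_injective (mul_right_cancel₀ I_ne_zero h1)
  rw [h2, show (n : ℝ) * (2 * π) / 2 = n * π by ring, Real.sin_int_mul_pi]

/-- With `φ` the half angle, `1 + e^{2iφ} = 2 cos φ e^{iφ}` and `1 - e^{2iφ} = -2i sin φ e^{iφ}`.
The value is purely imaginary, so the inner function is unimodular there. -/
lemma halfPlaneMap_exp {c θ : ℝ} (h : Real.sin ((θ - c) / 2) ≠ 0) :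
    halfPlaneMap (exp (-(c * I))) (exp (θ * I)) =
      (Real.cos ((θ - c) / 2) / Real.sin ((θ - c) / 2) : ℝ) * I := by
  have hne := one_sub_exp_ne_zero h
  have hs : Complex.sin (((θ - c) / 2 : ℝ)) ≠ 0 := by exact_mod_cast h
  have hE : exp (-(c * I)) * exp (θ * I) = exp (((θ - c) / 2 : ℝ) * I) ^ 2 := by
    rw [← Complex.exp_add, ← Complex.exp_nat_mul]
    congr 1
    push_cast
    ring
  rw [halfPlaneMap, div_eq_iff hne, hE]
  push_cast [ofReal_cos, ofReal_sin] at hs ⊢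
  rw [exp_mul_I]
  have h1 := Complex.sin_sq_add_cos_sq (((θ : ℂ) - c) / 2)
  set C := Complex.cos (((θ : ℂ) - c) / 2)
  set S := Complex.sin (((θ : ℂ) - c) / 2)
  have hA : 1 + (C + S * I) ^ 2 = 2 * C * (C + S * I) := by
    linear_combination -h1 + S ^ 2 * I_sq
  have hB : 1 - (C + S * I) ^ 2 = -2 * S * I * (C + S * I) := by
    linear_combination -h1 + S ^ 2 * I_sq
  rw [hA, hB]
  field_simp
  linear_combination (C * (C + S * I)) * I_sq

/-- Boundary values of an atomic singular inner function. -/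
lemma tendsto_exp_sum_halfPlaneMap {N : ℕ} {w x : Fin N → ℝ} {θ : ℝ} (h : θ ∈ regularAngles x)
    {r : ℕ → ℝ} (hr : Tendsto r atTop (𝓝 1)) :
    Tendsto (fun m => exp (-∑ j, (w j : ℂ) * halfPlaneMap (exp (-(x j * I))) (r m * exp (θ * I))))
      atTop (𝓝 (exp (atomicPhase w x θ * I))) := by
  have h1 : Tendsto (fun m => (r m : ℂ) * exp (θ * I)) atTop (𝓝 (exp (θ * I))) := by
    simpa using ((continuous_ofReal.tendsto 1).comp hr).mul_const (exp (θ * I))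
  have h2 : (atomicPhase w x θ : ℂ) * I =
      -∑ j, (w j : ℂ) * halfPlaneMap (exp (-(x j * I))) (exp (θ * I)) := by
    rw [Finset.sum_congr rfl fun j _ => by rw [halfPlaneMap_exp (h j)]]
    simp only [atomicPhase, ofReal_neg, ofReal_sum, ofReal_mul, neg_mul, Finset.sum_mul, mul_assoc]
  rw [h2]
  refine (continuous_exp.tendsto _).comp (Tendsto.neg (tendsto_finsetSum _ fun j _ =>
    Tendsto.const_mul _ ?_))
  have h3 : ContinuousAt (halfPlaneMap (exp (-(x j * I)))) (exp (θ * I)) :=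
    ContinuousAt.div (by fun_prop) (by fun_prop) (one_sub_exp_ne_zero (h j))
  exact h3.tendsto.comp h1

lemma countable_compl_regularAngles {N : ℕ} (x : Fin N → ℝ) : (regularAngles x)ᶜ.Countable := by
  have : (regularAngles x)ᶜ ⊆ ⋃ j : Fin N, ⋃ n : ℤ, {x j + 2 * (n * π)} := by
    intro θ hθ
    simp only [regularAngles, mem_compl_iff, mem_ofPred_eq, not_forall, not_not] at hθ
    obtain ⟨j, hj⟩ := hθ
    obtain ⟨n, hn⟩ := Real.sin_eq_zero_iff.1 hj
    simp only [mem_iUnion, mem_singleton_iff]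
    exact ⟨j, n, by linarith⟩
  exact (countable_iUnion fun j => countable_iUnion fun n => countable_singleton _).mono this

/-- Taylor coefficients of an atomic singular inner function are Fourier coefficients of its
boundary values. -/
lemma two_pi_mul_norm_taylorCoeffZero {f : ℂ → ℂ} (hf : KrzyzClass f) {N : ℕ} {ζ : ℂ}
    (hζ : ‖ζ‖ = 1) {w x : Fin N → ℝ}
    (hfx : ∀ z ∈ ball (0 : ℂ) 1,
      f z = ζ * exp (-∑ j, (w j : ℂ) * halfPlaneMap (exp (-(x j * I))) z)) (n : ℕ) (a : ℝ) :
    2 * π * ‖taylorCoeffZero n f‖ =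
      ‖∫ θ in a..(a + 2 * π), exp ((atomicPhase w x θ - n * θ : ℝ) * I)‖ := by
  set r : ℕ → ℝ := fun m => 1 - 1 / ((m : ℝ) + 2) with hr
  have hr2 : ∀ m, 1 / 2 ≤ r m := fun m => (one_sub_one_div_mem m).1
  have hr0 : ∀ m, 0 < r m := fun m => by linarith [hr2 m]
  have hr1 : ∀ m, r m < 1 := fun m => (one_sub_one_div_mem m).2
  have hball : ∀ m (θ : ℝ), (r m : ℂ) * exp (θ * I) ∈ ball (0 : ℂ) 1 := fun m θ => by
    rw [mem_ball_zero_iff, norm_mul, norm_exp_ofReal_mul_I, mul_one, norm_real,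
      Real.norm_of_nonneg (hr0 m).le]
    exact hr1 m
  set F : ℕ → ℝ → ℂ := fun m θ => f (r m * exp (θ * I)) / (r m * exp (θ * I)) ^ n with hF
  have hcoef : ∀ m, ∫ θ in a..(a + 2 * π), F m θ = 2 * π * taylorCoeffZero n f := by
    intro m
    have hper : Function.Periodic (F m) (2 * π) := by
      intro θ
      have : exp ((θ + 2 * π : ℝ) * I) = exp (θ * I) := by
        push_cast
        rw [add_mul, exp_periodic]
      simp only [hF, this]
    have h2 := hper.intervalIntegral_add_eq a 0
    rw [zero_add] at h2
    rw [h2, taylorCoeffZero_eq_circleAverage hf.1 (hr0 m) (hr1 m), circleAverage]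
    simp only [circleMap, zero_add, real_smul, hF]
    push_cast
    rw [← mul_assoc, mul_inv_cancel₀, one_mul]
    exact mul_ne_zero two_ne_zero (ofReal_ne_zero.2 Real.pi_ne_zero)
  have hlim : Tendsto (fun m => ∫ θ in a..(a + 2 * π), F m θ) atTop
      (𝓝 (∫ θ in a..(a + 2 * π), ζ * exp ((atomicPhase w x θ - n * θ : ℝ) * I))) := by
    -- Radii at least `1/2` give the dominating constant `2 ^ n`; the singular angles are countable,
    -- hence null.
    refine intervalIntegral.tendsto_integral_filter_of_dominated_convergence (fun _ => 2 ^ n)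
      (Eventually.of_forall fun m => ?_) (Eventually.of_forall fun m => ?_)
      intervalIntegrable_const ?_
    · have hc : Continuous (F m) := by
        refine Continuous.div ?_ (by fun_prop) fun θ =>
          pow_ne_zero _ (mul_ne_zero (ofReal_ne_zero.2 (hr0 m).ne') (exp_ne_zero _))
        exact hf.1.continuousOn.comp_continuous (by fun_prop) (hball m)
      exact hc.aestronglyMeasurable
    · refine Eventually.of_forall fun θ _ => ?_
      simp only [hF]
      rw [norm_div, norm_pow, norm_mul, norm_exp_ofReal_mul_I, mul_one, norm_real,
        Real.norm_of_nonneg (hr0 m).le]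
      calc ‖f (r m * exp (θ * I))‖ / r m ^ n ≤ 1 / (1 / 2) ^ n := by
            gcongr
            · exact (hf.2 _ (hball m θ)).2
            · exact hr2 m
        _ = 2 ^ n := by simp
    · have hae : ∀ᵐ θ : ℝ, θ ∈ regularAngles x := by
        rw [MeasureTheory.ae_iff]
        exact (countable_compl_regularAngles x).measure_zero _
      filter_upwards [hae] with θ hθ _
      have h1 := (tendsto_exp_sum_halfPlaneMap (w := w) hθ tendsto_one_sub_one_div).const_mul ζ
      have h2 : Tendsto (fun m => ((r m : ℂ) * exp (θ * I)) ^ n) atTop (𝓝 (exp (θ * I) ^ n)) := by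
        have := ((continuous_ofReal.tendsto 1).comp tendsto_one_sub_one_div).mul_const
          (exp (θ * I))
        simp only [ofReal_one, one_mul] at this
        exact this.pow n
      have h3 := h1.div h2 (pow_ne_zero _ (exp_ne_zero _))
      have e : ζ * exp (atomicPhase w x θ * I) / exp (θ * I) ^ n =
          ζ * exp ((atomicPhase w x θ - n * θ : ℝ) * I) := by
        rw [mul_div_assoc, ← Complex.exp_nat_mul, ← Complex.exp_sub]
        congr 2
        push_cast
        ring
      rw [e] at h3
      refine h3.congr fun m => ?_
      simp only [hF, Pi.div_apply]
      rw [hfx _ (hball m θ)]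
  simp only [hcoef, tendsto_const_nhds_iff] at hlim
  rw [intervalIntegral.integral_const_mul] at hlim
  have := congrArg norm hlim
  rw [norm_mul, norm_mul ζ, hζ, one_mul] at this
  rw [← this, ← ofReal_ofNat, ← ofReal_mul, norm_real, Real.norm_of_nonneg Real.two_pi_pos.le]

/-! ### Counting the atoms -/

lemma IsAtomicSingularInner.pos_of_isExtremalFor {f : ℂ → ℂ} {n N : ℕ} {ζ : ℂ} {w : Fin N → ℝ}
    {α : Fin N → ℂ} (h : IsAtomicSingularInner f N ζ w α) (hn : 1 ≤ n) (hf : IsExtremalFor n f) :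
    0 < N := by
  rcases Nat.eq_zero_or_pos N with rfl | h0
  · exfalso
    have h1 : EqOn f (fun _ => ζ) (ball 0 1) := fun z hz => by
      rw [h.2.2.2.2 z hz]
      simp
    have h2 := hf.two_div_exp_le hn
    rw [taylorCoeffZero_congr h1, taylorCoeffZero_const _ hn] at h2
    have : 0 < 2 / Real.exp 1 := by positivity
    rw [zero_re] at h2
    linarith
  · exact h0

/-- The number of atoms of an extremal function grows at least linearly. -/
theorem IsAtomicSingularInner.le_card_of_isExtremalFor {f : ℂ → ℂ} {n N : ℕ} {ζ : ℂ}
    {w : Fin N → ℝ} {α : Fin N → ℂ} (h : IsAtomicSingularInner f N ζ w α) (hn : 1 ≤ n)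
    (hf : IsExtremalFor n f) : 2 * π / 7 * (1 / Real.exp 1 - 1 / 3) * n ≤ N := by
  have hN := h.pos_of_isExtremalFor hn hf
  obtain ⟨v, x, hv, hx, h2, hfx⟩ := h.exists_strictMono_angles
  have hn0 : (0 : ℝ) < n := by exact_mod_cast hn
  -- These values give `(11/5) n · 2π|a_n| ≤ (14/5)πn + 38N`. The main term for `|a_n|` is `7/11`,
  -- below `2/e ≈ 0.736`.
  have hmain := norm_integral_exp_atomicPhase_le (w := v) hN (fun j => (hv j).le) hx h2 hn0
    (s := 2 / 5) (t := 1 / 5) (by norm_num) (by norm_num) (by norm_num)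
  rw [← two_pi_mul_norm_taylorCoeffZero hf.1 h.1 hfx n] at hmain
  have hcoef : 2 / Real.exp 1 ≤ ‖taylorCoeffZero n f‖ :=
    (hf.two_div_exp_le hn).trans (re_le_norm _)
  set E := 1 / Real.exp 1 with hE
  have hE1 : 2 / Real.exp 1 = 2 * E := by
    rw [hE]
    ring
  rw [hE1] at hcoef
  -- With `E = 1/e`, the estimate yields `N ≥ πn(44E - 14)/190`, which dominates `(2π/7)(E - 1/3)n`
  -- only when `E` is not too large; this is why an upper bound on `E` is needed.
  have hElt : E ≤ 0.37 := by
    rw [hE, div_le_iff₀ (Real.exp_pos 1)]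
    linarith [Real.exp_one_gt_d9]
  have hpn : 0 < π * n := by positivity
  have h3 : π * n * (2 * E) ≤ π * n * ‖taylorCoeffZero n f‖ :=
    mul_le_mul_of_nonneg_left hcoef hpn.le
  have h4 : π * n * E ≤ π * n * 0.37 := mul_le_mul_of_nonneg_left hElt hpn.le
  norm_num at hmain
  linarith

/-- Extremal functions for the `n`th coefficient are atomic singular inner functions with at least
`2π/7 (1/e - 1/3) n` atoms. -/
theorem theorem1 :
    ∃ c : ℝ, c = 2 * Real.pi / 7 * (1 / Real.exp 1 - 1 / 3) ∧ 0 < c ∧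
      ∀ (n : ℕ) (f : ℂ → ℂ), 1 ≤ n → IsExtremalFor n f →
        (∃ (N : ℕ) (ζ : ℂ) (w : Fin N → ℝ) (α : Fin N → ℂ), IsAtomicSingularInner f N ζ w α) ∧
        ∀ (N : ℕ) (ζ : ℂ) (w : Fin N → ℝ) (α : Fin N → ℂ),
          IsAtomicSingularInner f N ζ w α → c * (n : ℝ) ≤ (N : ℝ) := by
  refine ⟨_, rfl, ?_, fun n f hn hf => ⟨hf.exists_isAtomicSingularInner hn,
    fun N ζ w α h => h.le_card_of_isExtremalFor hn hf⟩⟩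
  have h1 : 1 / 3 < 1 / Real.exp 1 :=
    one_div_lt_one_div_of_lt (Real.exp_pos 1) (by linarith [Real.exp_one_lt_d9])
  exact mul_pos (by positivity) (sub_pos.2 h1)
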